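/- For positive integers $k_1,\dots,k_n$ with $k_1\ge 2$ let $$\zeta(k_1,\dots,k_n)=\sum_{m_1>m_2>\cdots>m_n>0}\frac{1}{m_1^{k_1}m_2^{k_2}\cdots m_n^{k_n}}$$ be the multiple zeta value, let $\zeta(l)$ be the value of the Riemann zeta function at $l$, and for integers $l>n\ge 1$ and $x,y\in\mathbb{C}$ put $$S_{l,n}(x,y)=\sum_{\substack{k_1\ge 2,\ k_2,\dots,k_n\ge 1\\ k_1+\cdots+k_n=l}} x^{k_1-1}\,y^{\,l-k_1-(n-1)}\,\zeta(k_1,\dots,k_n),$$ where $0^0=1$. Then for every integer $l\ge 3$ and all complex numbers $x,y$, $$\sum_{n=2}^{l-1}(y-x)^{n-2}\Bigl(S_{l,n}(x+y,y)+(-1)^n S_{l,n}(y+x,x)\Bigr)=\left[\frac{y^{l+1}-x^{l+1}}{yx(y-x)}-(y-x)^{l-2}\left((1+(-1)^l)\,\frac{2^{l-1}-1}{2^{l-1}}+(-1)^l\,\frac{x}{y}+\frac{y}{x}\right)\right]\zeta(l).$$ Here the expression in square brackets is a polynomial in $x$ and $y$, and for $x=0$, $y=0$ or $x=y$ it stands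 for the value of that polynomial. At $x=y=1$ its value is $l+1$, and the identity becomes the weighted Euler sum formula of Ohno and Zudilin, $$\sum_{j=2}^{l-1}2^{j}\,\zeta(j,l-j)=(l+1)\,\zeta(l).$$ -/

import Mathlib

namespace WeightedSumMZV

/-- The tuples `m₁ > m₂ > ⋯ > mₙ > 0` of natural numbers. -/
abbrev DecreasingTuple (n : ℕ) : Type :=
  {m : Fin n → ℕ // StrictAnti m ∧ ∀ i, 0 < m i}

/-- The multiple zeta value
`ζ(k₁, …, kₙ) = ∑_{m₁ > ⋯ > mₙ > 0} 1 / (m₁ ^ k₁ ⋯ mₙ ^ kₙ)`. -/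
noncomputable def mzv {n : ℕ} (k : Fin n → ℕ) : ℝ :=
  ∑' m : DecreasingTuple n, 1 / ∏ i, (m.1 i : ℝ) ^ k i

/-- The series defining `ζ(k₁, …, kₙ)` converges when `k₁ ≥ 2` and all `kᵢ ≥ 1`. -/
theorem summable_mzv {d : ℕ} (k : Fin (d + 1) → ℕ) (h0 : 2 ≤ k 0) (h : ∀ i, 1 ≤ k i) :
    Summable fun m : DecreasingTuple (d + 1) => 1 / ∏ i, (m.1 i : ℝ) ^ k i := by
  set e : ℝ := 1 / ((d : ℝ) + 1) with he
  have hd : (0 : ℝ) < (d : ℝ) + 1 := by positivity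
  have he0 : 0 < e := by positivity
  have hs : Summable fun a : ℕ => 1 / (a : ℝ) ^ (1 + e) :=
    Real.summable_one_div_nat_rpow.2 (by linarith)
  have hbound : ∀ m : DecreasingTuple (d + 1),
      1 / ∏ i, (m.1 i : ℝ) ^ k i ≤ ∏ i, 1 / (m.1 i : ℝ) ^ (1 + e) := by
    rintro ⟨m, hm, hpos⟩
    have hp : ∀ i, (1 : ℝ) ≤ m i := fun i => by exact_mod_cast hpos i
    have hp0 : ∀ i, (0 : ℝ) < m i := fun i => lt_of_lt_of_le one_pos (hp i)
    rw [Finset.prod_div_distrib, Finset.prod_const_one]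
    refine one_div_le_one_div_of_le (Finset.prod_pos fun i _ => Real.rpow_pos_of_pos (hp0 i) _) ?_
    have h1 : ∏ i, (m i : ℝ) ^ (1 + e) = (∏ i, (m i : ℝ)) * ∏ i, (m i : ℝ) ^ e := by
      rw [← Finset.prod_mul_distrib]
      exact Finset.prod_congr rfl fun i _ => by rw [Real.rpow_add (hp0 i), Real.rpow_one]
    have h2 : ∏ i, (m i : ℝ) ^ e ≤ m 0 := by
      calc ∏ i, (m i : ℝ) ^ e ≤ ∏ _i : Fin (d + 1), (m 0 : ℝ) ^ e :=
            Finset.prod_le_prod (fun i _ => (Real.rpow_pos_of_pos (hp0 i) _).le) fun i _ =>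
              Real.rpow_le_rpow (hp0 i).le (by exact_mod_cast hm.antitone (Fin.zero_le i)) he0.le
        _ = m 0 := by
            rw [Finset.prod_const, Finset.card_univ, Fintype.card_fin, ← Real.rpow_natCast,
              ← Real.rpow_mul (hp0 0).le]
            have : e * ((d + 1 : ℕ) : ℝ) = 1 := by
              rw [he]; push_cast; field_simp
            rw [this, Real.rpow_one]
    rw [h1]
    calc (∏ i, (m i : ℝ)) * ∏ i, (m i : ℝ) ^ e ≤ (∏ i, (m i : ℝ)) * m 0 :=
          mul_le_mul_of_nonneg_left h2 (Finset.prod_nonneg fun i _ => (hp0 i).le)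
      _ = (m 0 : ℝ) ^ 2 * ∏ i : Fin d, (m i.succ : ℝ) := by
          rw [Fin.prod_univ_succ]; ring
      _ ≤ (m 0 : ℝ) ^ k 0 * ∏ i : Fin d, (m i.succ : ℝ) ^ k i.succ := by
          refine mul_le_mul (pow_le_pow_right₀ (hp 0) h0) ?_
            (Finset.prod_nonneg fun i _ => (hp0 _).le) (pow_nonneg (hp0 0).le _)
          refine Finset.prod_le_prod (fun i _ => (hp0 _).le) fun i _ => ?_
          exact le_self_pow₀ (hp _) (by have := h i.succ; omega)
      _ = ∏ i, (m i : ℝ) ^ k i := (Fin.prod_univ_succ fun i => (m i : ℝ) ^ k i).symm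
  have hnn : ∀ m : Fin (d + 1) → ℕ, 0 ≤ ∏ i, 1 / (m i : ℝ) ^ (1 + e) := fun m =>
    Finset.prod_nonneg fun i _ => by positivity
  have hbig : Summable fun m : Fin (d + 1) → ℕ => ∏ i, 1 / (m i : ℝ) ^ (1 + e) := by
    refine summable_of_sum_le (c := ∏ _i : Fin (d + 1), ∑' a : ℕ, 1 / (a : ℝ) ^ (1 + e)) hnn ?_
    intro s
    have hsub : s ⊆ Fintype.piFinset fun i => s.image fun m => m i := fun m hm =>
      Fintype.mem_piFinset.2 fun i => Finset.mem_image_of_mem _ hm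
    refine (Finset.sum_le_sum_of_subset_of_nonneg hsub fun m _ _ => hnn m).trans ?_
    rw [← Finset.prod_univ_sum (fun i => s.image fun m => m i)
      (fun _ (a : ℕ) => 1 / (a : ℝ) ^ (1 + e))]
    refine Finset.prod_le_prod (fun i _ => Finset.sum_nonneg fun a _ => by positivity) fun i _ => ?_
    exact hs.sum_le_tsum _ fun a _ => by positivity
  refine Summable.of_nonneg_of_le (fun m => ?_) hbound (hbig.comp_injective Subtype.val_injective)
  exact one_div_nonneg.2 (Finset.prod_nonneg fun i _ => by positivity)

/-- The indices `(k₁, …, kₙ)` with `n = d + 1`, `k₁ ≥ 2`, `k₂, …, kₙ ≥ 1` and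
`k₁ + ⋯ + kₙ = l`. -/
def admissibleIndices (l d : ℕ) : Finset (Fin (d + 1) → ℕ) :=
  (Finset.Nat.antidiagonalTuple (d + 1) l).filter fun k => 2 ≤ k 0 ∧ ∀ i, 1 ≤ k i

/-- The weighted sum
`S_{l,n}(x, y) = ∑ x ^ (k₁ - 1) * y ^ (l - k₁ - (n - 1)) * ζ(k₁, …, kₙ)` over the indices
`k₁ ≥ 2`, `k₂, …, kₙ ≥ 1` with `k₁ + ⋯ + kₙ = l`. The depth `n` is positive; the value at `n = 0`
is the empty sum. The exponents are genuine natural numbers on this range. -/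
noncomputable def S (l : ℕ) : ℕ → ℂ → ℂ → ℂ
  | 0, _, _ => 0
  | d + 1, x, y =>
      ∑ k ∈ admissibleIndices l d, x ^ (k 0 - 1) * y ^ (l - k 0 - d) * (mzv k : ℂ)

end WeightedSumMZV

open Filter Topology Finset

namespace WeightedSumMZV

/-! Both sides are homogeneous of degree l − 2 in (x, y), so it suffices to compare generating
functions over l for real 0 < x < y ≤ 1/8, then coefficients along the rays (tx, ty).

Fix the largest summation variable m = i + 1 and sum over all weights and depths. The geometric
series in k₁ ≥ 2 gives 1/(m − X) − 1/m, the other exponents give elementary symmetric functions of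
the 1/(j − Y) with j < m, and summing over depth n with weight z^(n−2) gives (∏ (1 + z/(j − Y)) −
1)/z. For X = x + y, Y = y, z = y − x the product is (1 − x)_i/(1 − y)_i. The second half of the
left side is the same with x and y exchanged, and the contributions of the −1 cancel. What remains
is (A(x, y) − A(y, x))/(y − x), where A(x, y) = ∑ (1/(i + 1 − x − y) − 1/(i + 1)) (1 − x)_i/(1 −
y)_i (`hasSum_generating`, `hasSum_realLHS`).

Inserting 1/(i + 1 − y) between the two fractions splits A into (y/x)·`gaussSum` − `shiftSum`. The
first is a limiting case of Gauss's ₂F₁ summation, hence a difference of digamma series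
(`gaussSum_eq`). For the second only `shiftSum x y - shiftSum y x` is evaluated: it is unchanged
when x and y are translated by the same amount (`shiftSum_sub_swap_eq`), and translating to x + y =
0 turns `shiftSum` into −`gaussSum` (`shiftSum_sub_swap`).

Expanding the digamma series in powers with zeta values as coefficients yields the multiplier of
ζ(l). Finally both sides are polynomials, so agreement on a product of two infinite real sets gives
the identity on ℂ². -/

/-! ### Growth of ratios of Pochhammer symbols -/

/-- The ratio of Pochhammer symbols `(1 - x)_i / (1 - y)_i`. -/
noncomputable def pochRatio (x y : ℝ) (i : ℕ) : ℝ :=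
  ∏ j ∈ range i, ((j : ℝ) + 1 - x) / (j + 1 - y)

theorem pochRatio_succ (x y : ℝ) (i : ℕ) :
    pochRatio x y (i + 1) = pochRatio x y i * (((i : ℝ) + 1 - x) / (i + 1 - y)) :=
  prod_range_succ _ _

theorem pochRatio_zero (x y : ℝ) : pochRatio x y 0 = 1 := prod_range_zero _

theorem pochRatio_self {x : ℝ} (hx : x ≤ 1 / 8) (i : ℕ) : pochRatio x x i = 1 :=
  prod_eq_one fun j _ => div_self (by
    have : (0 : ℝ) ≤ j := j.cast_nonneg
    linarith)

theorem pochRatio_pos {x y : ℝ} (hx : x ≤ 1 / 8) (hy : y ≤ 1 / 8) (i : ℕ) :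
    0 < pochRatio x y i :=
  prod_pos fun j _ => by
    have : (0 : ℝ) ≤ j := j.cast_nonneg
    exact div_pos (by linarith) (by linarith)

/-- The ratio grows like i^(y − x), and y − x ≤ 1/4 leaves room for the cruder bound √(i + 1), still
summable against 1/(i + 1)². Here and in the series evaluations built on it x and y are bounded only
from above, so that the results apply at x − N and y − N. -/
theorem pochRatio_sq_le {x y : ℝ} (hx : x ≤ 1 / 8) (hy : y ≤ 1 / 8) (hxy : y - x ≤ 1 / 4)
    (i : ℕ) : pochRatio x y i ^ 2 ≤ i + 1 := by
  induction i with
  | zero => simp [pochRatio_zero]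
  | succ i ih =>
    have hi : (0 : ℝ) ≤ i := i.cast_nonneg
    have h1 : 0 < (i : ℝ) + 1 - y := by linarith
    have h2 : 0 < (i : ℝ) + 1 - x := by linarith
    have h3 : (((i : ℝ) + 1 - x) / (i + 1 - y)) ^ 2 ≤ (i + 2) / (i + 1) := by
      -- 2/7 = (1/4)/(7/8): the numerator exceeds the denominator by at most 1/4, and i + 1 − y ≥
      -- (7/8)(i + 1).
      have hle : ((i : ℝ) + 1 - x) / (i + 1 - y) ≤ 1 + 2 / 7 / (i + 1) := by
        rw [div_le_iff₀ h1]
        have : (1 + 2 / 7 / ((i : ℝ) + 1)) * (i + 1 - y) - (i + 1 - x)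
            = (2 / 7 * (i + 1 - y) - (i + 1) * (y - x)) / (i + 1) := by field_simp; ring
        have h4 : 0 ≤ (2 / 7 * ((i : ℝ) + 1 - y) - (i + 1) * (y - x)) / (i + 1) := by
          apply div_nonneg _ (by linarith); nlinarith
        linarith
      calc (((i : ℝ) + 1 - x) / (i + 1 - y)) ^ 2 ≤ (1 + 2 / 7 / ((i : ℝ) + 1)) ^ 2 :=
            pow_le_pow_left₀ (div_pos h2 h1).le hle 2
        _ ≤ (i + 2) / (i + 1) := by
            have : ((i : ℝ) + 2) / (i + 1) - (1 + 2 / 7 / ((i : ℝ) + 1)) ^ 2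
              = (3 / 7 * (i + 1) - 4 / 49) / (i + 1) ^ 2 := by field_simp; ring
            have : 0 ≤ (3 / 7 * ((i : ℝ) + 1) - 4 / 49) / (i + 1) ^ 2 :=
              div_nonneg (by linarith) (by positivity)
            linarith
    rw [pochRatio_succ, mul_pow]
    calc _ ≤ ((i : ℝ) + 1) * ((i + 2) / (i + 1)) :=
          mul_le_mul ih h3 (by positivity) (by positivity)
      _ = ((i + 1 : ℕ) : ℝ) + 1 := by push_cast; field_simp; ring

theorem pochRatio_le_sqrt {x y : ℝ} (hx : x ≤ 1 / 8) (hy : y ≤ 1 / 8) (hxy : y - x ≤ 1 / 4)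
    (i : ℕ) : pochRatio x y i ≤ √(i + 1) :=
  Real.le_sqrt_of_sq_le (pochRatio_sq_le hx hy hxy i)

theorem summable_sqrt_div_sq : Summable fun i : ℕ => √((i : ℝ) + 1) / ((i : ℝ) + 1) ^ 2 := by
  have h := (summable_nat_add_iff 1).2
    (Real.summable_one_div_nat_rpow.2 (show (1 : ℝ) < 3 / 2 by norm_num))
  refine h.congr fun i => ?_
  have hi : (0 : ℝ) < (i : ℝ) + 1 := by positivity
  push_cast
  rw [Real.sqrt_eq_rpow, ← Real.rpow_natCast, ← Real.rpow_sub hi, one_div, ← Real.rpow_neg hi.le]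
  norm_num

theorem tendsto_sqrt_div : Tendsto (fun i : ℕ => √((i : ℝ) + 1) / ((i : ℝ) + 1)) atTop (𝓝 0) := by
  have h : Tendsto (fun i : ℕ => (√((i : ℝ) + 1))⁻¹) atTop (𝓝 0) :=
    tendsto_inv_atTop_zero.comp (Real.tendsto_sqrt_atTop.comp
      (tendsto_atTop_add_const_right _ _ tendsto_natCast_atTop_atTop))
  refine h.congr fun i => ?_
  rw [Real.sqrt_div_self', one_div]

/-- Comparison of a weighted term with the summable sequence `√(i + 1) / (i + 1) ^ 2`. -/
theorem pochRatio_div_le {x y p q : ℝ} (hx : x ≤ 1 / 8) (hy : y ≤ 1 / 8) (hxy : y - x ≤ 1 / 4)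
    (hp : p ≤ 1 / 2) (hq : q ≤ 1 / 2) (i : ℕ) :
    pochRatio x y i / (((i : ℝ) + 1 - p) * (i + 1 - q)) ≤ 4 * (√((i : ℝ) + 1) / (i + 1) ^ 2) := by
  have hi : (0 : ℝ) ≤ i := i.cast_nonneg
  have h1 : ((i : ℝ) + 1) / 2 ≤ i + 1 - p := by linarith
  have h2 : ((i : ℝ) + 1) / 2 ≤ i + 1 - q := by linarith
  have h3 : (((i : ℝ) + 1) / 2) * ((i + 1) / 2) ≤ ((i : ℝ) + 1 - p) * (i + 1 - q) :=
    mul_le_mul h1 h2 (by positivity) (by linarith)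
  calc _ ≤ √((i : ℝ) + 1) / ((((i : ℝ) + 1) / 2) * ((i + 1) / 2)) :=
        div_le_div₀ (Real.sqrt_nonneg _) (pochRatio_le_sqrt hx hy hxy i) (by positivity) h3
    _ = _ := by field_simp; ring

theorem summable_pochRatio_div {x y p q : ℝ} (hx : x ≤ 1 / 8) (hy : y ≤ 1 / 8)
    (hxy : y - x ≤ 1 / 4) (hp : p ≤ 1 / 2) (hq : q ≤ 1 / 2) :
    Summable fun i : ℕ => pochRatio x y i / (((i : ℝ) + 1 - p) * (i + 1 - q)) := by
  refine Summable.of_nonneg_of_le (fun i => ?_) (pochRatio_div_le hx hy hxy hp hq)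
    (summable_sqrt_div_sq.mul_left 4)
  have hi : (0 : ℝ) ≤ i := i.cast_nonneg
  exact div_nonneg (pochRatio_pos hx hy i).le (mul_nonneg (by linarith) (by linarith))

theorem tendsto_pochRatio_div {x y p : ℝ} (hx : x ≤ 1 / 8) (hy : y ≤ 1 / 8)
    (hxy : y - x ≤ 1 / 4) (hp : p ≤ 1 / 2) :
    Tendsto (fun i : ℕ => pochRatio x y i / ((i : ℝ) + 1 - p)) atTop (𝓝 0) := by
  have h := tendsto_sqrt_div.const_mul 2
  rw [mul_zero] at h
  refine squeeze_zero (fun i => ?_) (fun i => ?_) h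
  · have hi : (0 : ℝ) ≤ i := i.cast_nonneg
    exact div_nonneg (pochRatio_pos hx hy i).le (by linarith)
  · have hi : (0 : ℝ) ≤ i := i.cast_nonneg
    calc _ ≤ √((i : ℝ) + 1) / (((i : ℝ) + 1) / 2) :=
        div_le_div₀ (Real.sqrt_nonneg _) (pochRatio_le_sqrt hx hy hxy i) (by positivity)
          (by linarith)
      _ = _ := by field_simp

theorem hasSum_sub_of_tendsto_zero {w : ℕ → ℝ} {f : ℕ → ℝ} (hf : Summable f)
    (h : ∀ i, f i = w i - w (i + 1)) (hw : Tendsto w atTop (𝓝 0)) : HasSum f (w 0) := by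
  refine (hf.hasSum_iff_tendsto_nat).2 ?_
  have : ∀ n, ∑ i ∈ range n, f i = w 0 - w n := fun n => by
    rw [← sum_range_sub' w n]; exact sum_congr rfl fun i _ => h i
  simp only [this]
  simpa using tendsto_const_nhds.sub hw

/-! ### The digamma series -/

/-- The series `∑ (1 / (m - z) - 1 / m)`, that is `-ψ(1 - z) - γ`. -/
noncomputable def digammaSum (z : ℝ) : ℝ := ∑' i : ℕ, (1 / ((i : ℝ) + 1 - z) - 1 / (i + 1))

theorem summable_digammaSum {z : ℝ} (hz : z ≤ 1 / 2) :
    Summable fun i : ℕ => 1 / ((i : ℝ) + 1 - z) - 1 / (i + 1) := by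
  have h := (summable_pochRatio_div (x := 0) (y := 0) (p := 0) (q := z) (by norm_num)
    (by norm_num) (by norm_num) (by norm_num) hz).mul_left z
  refine h.congr fun i => ?_
  have hi : (0 : ℝ) ≤ i := i.cast_nonneg
  have h1 : (i : ℝ) + 1 - z ≠ 0 := by linarith
  have h2 : (i : ℝ) + 1 ≠ 0 := by linarith
  rw [pochRatio_self (by norm_num)]; field_simp; ring

/-- The sum `∑ x (1 - x)_i / ((i + 1) (1 - y)_{i + 1})`. -/
noncomputable def gaussSum (x y : ℝ) : ℝ :=
  ∑' i : ℕ, x * (pochRatio x y i / (((i : ℝ) + 1 - 0) * (i + 1 - y)))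

theorem pochRatio_sub_one_right {x y : ℝ} (hy : y ≤ 1 / 8) (i : ℕ) :
    pochRatio x (y - 1) i = pochRatio x y i * ((1 - y) / (i + 1 - y)) := by
  induction i with
  | zero => simp [pochRatio_zero, div_self (show 1 - y ≠ 0 by linarith)]
  | succ i ih =>
    have hi : (0 : ℝ) ≤ i := i.cast_nonneg
    have h1 : (i : ℝ) + 1 - y ≠ 0 := by linarith
    have h2 : (i : ℝ) + 1 + 1 - y ≠ 0 := by linarith
    have h3 : (i : ℝ) + 1 - (y - 1) ≠ 0 := by linarith
    rw [pochRatio_succ, pochRatio_succ, ih]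
    push_cast
    field_simp
    ring

/-- Contiguity in y: the termwise difference telescopes, and the boundary term is exactly the
increment of `digammaSum y - digammaSum (y - x)`. -/
theorem gaussSum_sub_one {x y : ℝ} (hx : x ≤ 1 / 8) (hy : y ≤ 1 / 8) (hxy : y - x ≤ 1 / 4) :
    gaussSum x y = gaussSum x (y - 1) + (1 / (1 - y) - 1 / (1 - (y - x))) := by
  have s1 := (summable_pochRatio_div (p := 0) (q := y) hx hy hxy (by norm_num)
    (by linarith)).mul_left x
  have s2 := (summable_pochRatio_div (y := y - 1) (p := 0) (q := y - 1) hx (by linarith)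
    (by linarith) (by norm_num) (by linarith)).mul_left x
  -- The telescoping certificate: this sequence has the termwise difference of the two series as its
  -- successive differences.
  have hw : Tendsto (fun i : ℕ => x / (1 - (y - x)) * (pochRatio x y i / ((i : ℝ) + 1 - y)))
      atTop (𝓝 0) := by
    simpa using (tendsto_pochRatio_div (p := y) hx hy hxy (by linarith)).const_mul
      (x / (1 - (y - x)))
  have h := hasSum_sub_of_tendsto_zero (s1.sub s2) (fun i => ?_) hw
  · have h' := h.unique (s1.hasSum.sub s2.hasSum)
    rw [← gaussSum, ← gaussSum, pochRatio_zero] at h'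
    have h1 : 1 - y ≠ 0 := by linarith
    have h2 : 1 - (y - x) ≠ 0 := by linarith
    have : x / (1 - (y - x)) * (1 / (((0 : ℕ) : ℝ) + 1 - y)) = 1 / (1 - y) - 1 / (1 - (y - x)) := by
      have h3 : ((0 : ℕ) : ℝ) + 1 - y ≠ 0 := by simpa using h1
      push_cast at *
      field_simp; ring
    linarith
  · have hi : (0 : ℝ) ≤ i := i.cast_nonneg
    have h1 : (i : ℝ) + 1 - y ≠ 0 := by linarith
    have h2 : (i : ℝ) + 1 + 1 - y ≠ 0 := by linarith
    have h3 : (i : ℝ) + 1 - (y - 1) ≠ 0 := by linarith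
    have h4 : (i : ℝ) + 1 ≠ 0 := by linarith
    have h5 : 1 - (y - x) ≠ 0 := by linarith
    rw [pochRatio_sub_one_right hy, pochRatio_succ]
    push_cast
    rw [show (i : ℝ) + 1 - (y - 1) = i + 1 + 1 - y by ring, sub_zero]
    field_simp
    ring

/-- Dominated convergence: lowering y keeps the ratio below √(i + 1), while each term acquires a
denominator growing with N. -/
theorem tendsto_gaussSum_sub_nat {x y : ℝ} (hx : x ≤ 1 / 8) (hy : y ≤ 1 / 8)
    (hxy : y - x ≤ 1 / 4) : Tendsto (fun N : ℕ => gaussSum x (y - N)) atTop (𝓝 0) := by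
  rw [← tsum_zero (α := ℝ) (β := ℕ)]
  refine tendsto_tsum_of_dominated_convergence
    (bound := fun i : ℕ => |x| * (4 * (√((i : ℝ) + 1) / (i + 1) ^ 2)))
    ((summable_sqrt_div_sq.mul_left 4).mul_left |x|) (fun i => ?_) (Eventually.of_forall ?_)
  · have hi : (0 : ℝ) ≤ i := i.cast_nonneg
    have hlim : Tendsto (fun N : ℕ => |x| * √((i : ℝ) + 1) / ((i + 1) * (i + 1 - y + N)))
        atTop (𝓝 0) := by
      refine tendsto_const_nhds.div_atTop (Tendsto.const_mul_atTop (by positivity) ?_)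
      exact tendsto_atTop_add_const_left _ _ tendsto_natCast_atTop_atTop
    refine squeeze_zero_norm (fun N => ?_) hlim
    have hN : (0 : ℝ) ≤ N := N.cast_nonneg
    rw [norm_mul, Real.norm_eq_abs, Real.norm_eq_abs, abs_div,
      abs_of_pos (pochRatio_pos hx (by linarith) i), sub_zero, mul_div_assoc,
      abs_of_pos (mul_pos (by positivity) (by linarith) : 0 < ((i : ℝ) + 1) * (i + 1 - (y - N))),
      show (i : ℝ) + 1 - (y - N) = i + 1 - y + N by ring]
    exact mul_le_mul_of_nonneg_left (div_le_div_of_nonneg_right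
      (pochRatio_le_sqrt hx (by linarith) (by linarith) i)
      (mul_nonneg (by linarith) (by linarith))) (abs_nonneg x)
  · intro N i
    have hi : (0 : ℝ) ≤ i := i.cast_nonneg
    have hN : (0 : ℝ) ≤ N := N.cast_nonneg
    rw [norm_mul, Real.norm_eq_abs, Real.norm_eq_abs, abs_div,
      abs_of_pos (pochRatio_pos hx (by linarith) i), abs_of_pos
        (mul_pos (by linarith) (by linarith) : 0 < ((i : ℝ) + 1 - 0) * (i + 1 - (y - N)))]
    exact mul_le_mul_of_nonneg_left (pochRatio_div_le hx (by linarith) (by linarith) (by norm_num)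
      (by linarith) i) (abs_nonneg x)

/-- This is the derivative at b = 0 of Gauss's formula for ₂F₁(−x, b; 1 − y; 1). Iterating the
contiguity relation makes the partial sums of the digamma difference equal to `gaussSum x y -
gaussSum x (y - N)`, whose last term tends to 0. -/
theorem gaussSum_eq {x y : ℝ} (hx : x ≤ 1 / 8) (hy : y ≤ 1 / 8) (hxy : y - x ≤ 1 / 4) :
    gaussSum x y = digammaSum y - digammaSum (y - x) := by
  have hs := (summable_digammaSum (z := y) (by linarith)).sub
    (summable_digammaSum (z := y - x) (by linarith))
  have h1 : ∀ N : ℕ, ∑ i ∈ range N, ((1 / ((i : ℝ) + 1 - y) - 1 / (i + 1)) -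
      (1 / ((i : ℝ) + 1 - (y - x)) - 1 / (i + 1))) = gaussSum x y - gaussSum x (y - N) := by
    intro N
    induction N with
    | zero => simp
    | succ N ih =>
      have hN : (0 : ℝ) ≤ N := N.cast_nonneg
      have := gaussSum_sub_one (y := y - N) hx (by linarith) (by linarith)
      rw [sum_range_succ, ih, this]
      push_cast
      rw [show y - (N : ℝ) - 1 = y - (N + 1) by ring,
        show 1 - (y - (N : ℝ)) = N + 1 - y by ring,
        show 1 - (y - (N : ℝ) - x) = N + 1 - (y - x) by ring]
      ring
  have h2 := (hs.hasSum_iff_tendsto_nat (m := gaussSum x y)).2 <| by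
    simp only [h1]
    simpa using tendsto_const_nhds.sub (tendsto_gaussSum_sub_nat hx hy hxy)
  rw [← h2.tsum_eq, Summable.tsum_sub (summable_digammaSum (by linarith))
    (summable_digammaSum (by linarith))]
  rfl

/-! ### A shift-invariant difference -/

/-- The sum `∑ -x (1 - x)_i / ((i + 1 - x - y) (1 - y)_{i + 1})`. -/
noncomputable def shiftSum (x y : ℝ) : ℝ :=
  ∑' i : ℕ, -x * (pochRatio x y i / (((i : ℝ) + 1 - (x + y)) * (i + 1 - y)))

theorem summable_shiftSum {x y : ℝ} (hx : x ≤ 1 / 8) (hy : y ≤ 1 / 8) (hxy : y - x ≤ 1 / 4) :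
    Summable fun i : ℕ => -x * (pochRatio x y i / (((i : ℝ) + 1 - (x + y)) * (i + 1 - y))) :=
  (summable_pochRatio_div (p := x + y) (q := y) hx hy hxy (by linarith) (by linarith)).mul_left _

theorem pochRatio_sub_one {x y : ℝ} (hx : x ≤ 1 / 8) (hy : y ≤ 1 / 8) (i : ℕ) :
    pochRatio (x - 1) (y - 1) i = pochRatio x y (i + 1) * ((1 - y) / (1 - x)) := by
  have h1 : 1 - y ≠ 0 := by linarith
  have h2 : 1 - x ≠ 0 := by linarith
  induction i with
  | zero => simp [pochRatio_zero, pochRatio_succ]; field_simp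
  | succ i ih =>
    rw [pochRatio_succ, ih, pochRatio_succ x y (i + 1)]
    push_cast
    rw [show (i : ℝ) + 1 - (x - 1) = i + 1 + 1 - x by ring,
      show (i : ℝ) + 1 - (y - 1) = i + 1 + 1 - y by ring]
    ring

/-- Term i of the shifted series is compared with term i + 1 of the original one, and the difference
telescopes. The resulting increment depends only on x + y, so it cancels in `shiftSum x y - shiftSum
y x`. -/
theorem shiftSum_sub_one {x y : ℝ} (hx : x ≤ 1 / 8) (hy : y ≤ 1 / 8) (hxy : y - x ≤ 1 / 4) :
    shiftSum (x - 1) (y - 1) = shiftSum x y + 1 / ((1 - (x + y)) * (2 - (x + y))) := by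
  have s1 := summable_shiftSum hx hy hxy
  have s1' := (summable_nat_add_iff 1).2 s1
  have s2 := summable_shiftSum (x := x - 1) (y := y - 1) (by linarith) (by linarith) (by linarith)
  have hw : Tendsto (fun i : ℕ => pochRatio x y (i + 1) / (((i + 1 : ℕ) : ℝ) + 1 - (x + y)))
      atTop (𝓝 0) :=
    (tendsto_pochRatio_div (p := x + y) hx hy hxy (by linarith)).comp (tendsto_add_atTop_nat 1)
  have e1 : 1 - y ≠ 0 := by linarith
  have e2 : 1 - x ≠ 0 := by linarith
  have h := hasSum_sub_of_tendsto_zero (s2.sub s1') (fun i => ?_) hw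
  · have h' := h.unique (s2.hasSum.sub s1'.hasSum)
    have h0 := s1.tsum_eq_zero_add
    rw [← shiftSum] at h' h0
    replace h0 := sub_eq_of_eq_add' h0
    rw [← h0] at h'
    rw [pochRatio_succ, pochRatio_zero] at h'
    push_cast at h'
    have e3 : 1 - (x + y) ≠ 0 := by linarith
    have e4 : 2 - (x + y) ≠ 0 := by linarith
    simp only [zero_add, one_mul] at h'
    rw [show (1 : ℝ) + 1 - (x + y) = 2 - (x + y) by ring] at h'
    have h5 : shiftSum (x - 1) (y - 1) - shiftSum x y =
      (1 - x) / (1 - y) / (2 - (x + y)) + x * (1 / ((1 - (x + y)) * (1 - y))) := by linarith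
    have h6 : (1 - x) / (1 - y) / (2 - (x + y)) + x * (1 / ((1 - (x + y)) * (1 - y))) =
        1 / ((1 - (x + y)) * (2 - (x + y))) := by
      field_simp; ring
    linarith
  · have hi : (0 : ℝ) ≤ i := i.cast_nonneg
    have h1 : (i : ℝ) + 1 + 1 - y ≠ 0 := by linarith
    have h2 : (i : ℝ) + 1 + 1 - (x + y) ≠ 0 := by linarith
    have h3 : (i : ℝ) + 1 + 1 + 1 - (x + y) ≠ 0 := by linarith
    rw [pochRatio_sub_one hx hy, pochRatio_succ x y (i + 1)]
    push_cast
    rw [show (i : ℝ) + 1 - (x - 1 + (y - 1)) = i + 1 + 1 + 1 - (x + y) by ring,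
      show (i : ℝ) + 1 - (y - 1) = i + 1 + 1 - y by ring]
    field_simp
    ring

theorem shiftSum_sub_nat {x y : ℝ} (hx : x ≤ 1 / 8) (hy : y ≤ 1 / 8) (hxy : y - x ≤ 1 / 4)
    (N : ℕ) : shiftSum (x - N) (y - N) = shiftSum x y +
      ∑ k ∈ range N, 1 / ((1 + 2 * (k : ℝ) - (x + y)) * (2 + 2 * k - (x + y))) := by
  induction N with
  | zero => simp
  | succ N ih =>
    have hN : (0 : ℝ) ≤ N := N.cast_nonneg
    have := shiftSum_sub_one (x := x - N) (y := y - N) (by linarith) (by linarith) (by linarith)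
    rw [sum_range_succ, ← add_assoc, ← ih]
    push_cast
    rw [show x - ((N : ℝ) + 1) = x - N - 1 by ring, show y - ((N : ℝ) + 1) = y - N - 1 by ring,
      this]
    congr 3 <;> ring

/-- The accumulated increment E is common to both orders of the arguments because it is symmetric in
x and y. -/
theorem exists_tendsto_shiftSum {x y : ℝ} (hx : x ≤ 1 / 8) (hy : y ≤ 1 / 8)
    (hxy : |y - x| ≤ 1 / 4) : ∃ E : ℝ,
      Tendsto (fun N : ℕ => shiftSum (x - N) (y - N)) atTop (𝓝 (shiftSum x y + E)) ∧
      Tendsto (fun N : ℕ => shiftSum (y - N) (x - N)) atTop (𝓝 (shiftSum y x + E)) := by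
  obtain ⟨h1, h2⟩ := abs_le.1 hxy
  have hs : Summable fun k : ℕ => 1 / ((1 + 2 * (k : ℝ) - (x + y)) * (2 + 2 * k - (x + y))) := by
    refine Summable.of_nonneg_of_le (fun k => ?_) (fun k => ?_)
      (summable_pochRatio_div (x := 0) (y := 0) (p := 0) (q := x + y) (by norm_num)
        (by norm_num) (by norm_num) (by norm_num) (by linarith))
    · have hk : (0 : ℝ) ≤ k := k.cast_nonneg
      exact one_div_nonneg.2 (mul_nonneg (by linarith) (by linarith))
    · have hk : (0 : ℝ) ≤ k := k.cast_nonneg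
      rw [pochRatio_self (by norm_num)]
      refine one_div_le_one_div_of_le (mul_pos (by linarith) (by linarith)) ?_
      rw [mul_comm]
      exact mul_le_mul (by linarith) (by linarith) (by linarith) (by linarith)
  refine ⟨∑' k : ℕ, 1 / ((1 + 2 * (k : ℝ) - (x + y)) * (2 + 2 * k - (x + y))), ?_, ?_⟩
  · simp only [shiftSum_sub_nat hx hy h2]
    exact tendsto_const_nhds.add hs.hasSum.tendsto_sum_nat
  · simp only [shiftSum_sub_nat hy hx (show x - y ≤ 1 / 4 by linarith), add_comm y x]
    exact tendsto_const_nhds.add hs.hasSum.tendsto_sum_nat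

/-! ### Asymptotic independence of translations -/

/-- Translating by t changes the factor at n = N + i + 1 by a relative error O(1/n²), small enough
to be absorbed by 1 − 1/n². The product of (n − 1)(n + 1)/n² over N < n ≤ N + i telescopes to N(N +
i + 1)/((N + 1)(N + i)), the weights seen here. -/
theorem pochRatio_sub_nat_le {x y t : ℝ} (hx : |x| ≤ 1 / 8) (hy : |y| ≤ 1 / 8)
    (hx' : |x + t| ≤ 1 / 8) (hy' : |y + t| ≤ 1 / 8) {N : ℕ} (hN : 1 ≤ N) (i : ℕ) :
    pochRatio (x - N) (y - N) i * (N * (N + i + 1)) ≤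
      pochRatio (x + t - N) (y + t - N) i * ((N + 1) * (N + i)) := by
  have hN' : (1 : ℝ) ≤ N := by exact_mod_cast hN
  rw [abs_le] at hx hy hx'
  have hy1 := abs_le.1 hy'
  induction i with
  | zero => simp [pochRatio_zero]; linarith
  | succ i ih =>
    have hi : (0 : ℝ) ≤ i := i.cast_nonneg
    set n : ℝ := N + i + 1 with hn
    have hn2 : 2 ≤ n := by linarith
    have hb : (n - x) / (n - y) * ((n - 1) * (n + 1)) ≤
        (n - (x + t)) / (n - (y + t)) * (n * n) := by
      rw [div_mul_eq_mul_div, div_mul_eq_mul_div, div_le_div_iff₀ (by linarith) (by linarith)]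
      have h1 : (n - x) * (n - (y + t)) = (n - (x + t)) * (n - y) - t * (y - x) := by ring
      have ht : |t * (y - x)| ≤ 1 / 4 * (1 / 4) := by
        rw [abs_mul]
        exact mul_le_mul (abs_le.2 ⟨by linarith, by linarith⟩)
          (abs_le.2 ⟨by linarith, by linarith⟩) (abs_nonneg _) (by norm_num)
      rw [abs_le] at ht
      have h3 : (n / 2) * (n / 2) ≤ (n - (x + t)) * (n - y) :=
        mul_le_mul (by linarith) (by linarith) (by linarith) (by linarith)
      nlinarith
    have hp := pochRatio_pos (x := x - N) (y := y - N) (by linarith) (by linarith) i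
    have hp' := pochRatio_pos (x := x + t - N) (y := y + t - N) (by linarith) (by linarith) i
    have hq : 0 ≤ (n - (x + t)) / (n - (y + t)) := div_nonneg (by linarith) (by linarith)
    rw [pochRatio_succ, pochRatio_succ,
      show (i : ℝ) + 1 - (x - N) = n - x by rw [hn]; ring,
      show (i : ℝ) + 1 - (y - N) = n - y by rw [hn]; ring,
      show (i : ℝ) + 1 - (x + t - N) = n - (x + t) by rw [hn]; ring,
      show (i : ℝ) + 1 - (y + t - N) = n - (y + t) by rw [hn]; ring]
    push_cast
    rw [show (N : ℝ) + (i + 1) + 1 = n + 1 by rw [hn]; ring,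
      show (N : ℝ) + (i + 1) = n by rw [hn]; ring]
    rw [show (N : ℝ) + i = n - 1 by rw [hn]; ring] at ih
    have hn1 : 0 < n * (n - 1) := mul_pos (by linarith) (by linarith)
    refine le_of_mul_le_mul_right ?_ hn1
    calc _ = (pochRatio (x - N) (y - N) i * (N * n)) *
          ((n - x) / (n - y) * ((n - 1) * (n + 1))) := by ring
      _ ≤ (pochRatio (x + t - N) (y + t - N) i * ((N + 1) * (n - 1))) *
          ((n - (x + t)) / (n - (y + t)) * (n * n)) :=
        mul_le_mul ih hb (mul_nonneg (div_nonneg (by linarith) (by linarith))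
          (mul_nonneg (by linarith) (by linarith)))
          (mul_nonneg hp'.le (mul_nonneg (by linarith) (by linarith)))
      _ = _ := by ring

/-- Each term consists of four positive factors (prefactor, Pochhammer ratio, two denominators), and
each costs at most 1 + 1/N under the translation. -/
theorem shiftSum_sub_nat_le {x y t : ℝ} (hx : |x| ≤ 1 / 8) (hy : |y| ≤ 1 / 8)
    (hx' : |x + t| ≤ 1 / 8) (hy' : |y + t| ≤ 1 / 8) {N : ℕ} (hN : 1 ≤ N) :
    shiftSum (x - N) (y - N) ≤ (1 + 1 / (N : ℝ)) ^ 4 * shiftSum (x + t - N) (y + t - N) := by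
  have hN' : (1 : ℝ) ≤ N := by exact_mod_cast hN
  have hmain := fun i => pochRatio_sub_nat_le hx hy hx' hy' hN i
  rw [abs_le] at hx hy hx' hy'
  rw [shiftSum, shiftSum, ← tsum_mul_left]
  refine Summable.tsum_le_tsum (fun i => ?_)
    (summable_shiftSum (by linarith) (by linarith) (by linarith))
    ((summable_shiftSum (by linarith) (by linarith) (by linarith)).mul_left _)
  have hi : (0 : ℝ) ≤ i := i.cast_nonneg
  set r : ℝ := 1 + 1 / (N : ℝ) with hr
  have hr0 : 0 < r := by positivity
  have hrN : r * N = N + 1 := by rw [hr]; field_simp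
  have key : ∀ c u v : ℝ, N ≤ c → v - u ≤ 1 / 2 → v ≤ 1 / 4 → c - u ≤ r * (c - v) := by
    intro c u v hc huv hv
    have : v - u ≤ 1 / N * (c - v) := by
      rw [one_div_mul_eq_div, le_div_iff₀ (by linarith)]
      nlinarith
    rw [hr]; linarith
  have hp : pochRatio (x - N) (y - N) i ≤ r * pochRatio (x + t - N) (y + t - N) i := by
    have hp' := pochRatio_pos (x := x + t - N) (y := y + t - N) (by linarith) (by linarith) i
    refine le_of_mul_le_mul_right ?_ (show (0 : ℝ) < N * (N + i + 1) by positivity)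
    refine (hmain i).trans ?_
    rw [← hrN]
    have : r * N * (N + i) ≤ r * N * (N + i + 1) :=
      mul_le_mul_of_nonneg_left (by linarith) (by positivity)
    nlinarith
  have h1 := key N x (x + t) le_rfl (by linarith) (by linarith)
  have h2 := key (i + 1 + N) (y + t) y (by linarith) (by linarith) (by linarith)
  have h3 := key (i + 1 + 2 * N) (x + y + 2 * t) (x + y) (by linarith) (by linarith) (by linarith)
  rw [show -(x - (N : ℝ)) = N - x by ring, show -(x + t - (N : ℝ)) = N - (x + t) by ring,
    show (i : ℝ) + 1 - (x - N + (y - N)) = i + 1 + 2 * N - (x + y) by ring,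
    show (i : ℝ) + 1 - (y - N) = i + 1 + N - y by ring,
    show (i : ℝ) + 1 - (x + t - N + (y + t - N)) = i + 1 + 2 * N - (x + y + 2 * t) by ring,
    show (i : ℝ) + 1 - (y + t - N) = i + 1 + N - (y + t) by ring]
  have hp0 := pochRatio_pos (x := x - N) (y := y - N) (by linarith) (by linarith) i
  have g1 : 0 < (N : ℝ) - (x + t) := by linarith
  have g2 : 0 < (i : ℝ) + 1 + N - y := by linarith
  have g2' : 0 < (i : ℝ) + 1 + N - (y + t) := by linarith
  have g3 : 0 < (i : ℝ) + 1 + 2 * N - (x + y) := by linarith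
  have g3' : 0 < (i : ℝ) + 1 + 2 * N - (x + y + 2 * t) := by linarith
  rw [mul_div_assoc', mul_div_assoc', mul_div_assoc', div_le_div_iff₀ (mul_pos g3 g2)
    (mul_pos g3' g2')]
  calc _ ≤ ((r * (N - (x + t))) * (r * pochRatio (x + t - N) (y + t - N) i)) *
        ((r * (i + 1 + 2 * N - (x + y))) * (r * (i + 1 + N - y))) := by
        refine mul_le_mul (mul_le_mul h1 hp hp0.le (by positivity))
          (mul_le_mul h3 h2 g2'.le (by positivity)) (by positivity) ?_
        exact mul_nonneg (by positivity) (hp0.le.trans hp)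
    _ = _ := by ring

/-- The limits of `shiftSum (x - N) (y - N)` before and after translation coincide, since their
ratio is squeezed by (1 + 1/N)⁴. Subtracting the limits for the two orders removes the common
increments. -/
theorem shiftSum_sub_swap_eq {x y t : ℝ} (hx : |x| ≤ 1 / 8) (hy : |y| ≤ 1 / 8)
    (hx' : |x + t| ≤ 1 / 8) (hy' : |y + t| ≤ 1 / 8) :
    shiftSum x y - shiftSum y x = shiftSum (x + t) (y + t) - shiftSum (y + t) (x + t) := by
  have hr : Tendsto (fun N : ℕ => (1 + 1 / (N : ℝ)) ^ 4) atTop (𝓝 1) := by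
    simpa using ((tendsto_const_nhds (x := (1 : ℝ))).add tendsto_one_div_atTop_nhds_zero_nat).pow 4
  have hle : ∀ {x y t : ℝ}, |x| ≤ 1 / 8 → |y| ≤ 1 / 8 → |x + t| ≤ 1 / 8 → |y + t| ≤ 1 / 8 →
      ∀ {L L' : ℝ}, Tendsto (fun N : ℕ => shiftSum (x - N) (y - N)) atTop (𝓝 L) →
      Tendsto (fun N : ℕ => shiftSum (x + t - N) (y + t - N)) atTop (𝓝 L') → L ≤ L' := by
    intro x y t hx hy hx' hy' L L' h h'
    have := hr.mul h'
    rw [one_mul] at this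
    refine le_of_tendsto_of_tendsto h this ?_
    filter_upwards [eventually_ge_atTop 1] with N hN
    exact shiftSum_sub_nat_le hx hy hx' hy' hN
  -- The reverse inequality is the same estimate for the translation by −t.
  have heq : ∀ {x y t : ℝ}, |x| ≤ 1 / 8 → |y| ≤ 1 / 8 → |x + t| ≤ 1 / 8 → |y + t| ≤ 1 / 8 →
      ∀ {L L' : ℝ}, Tendsto (fun N : ℕ => shiftSum (x - N) (y - N)) atTop (𝓝 L) →
      Tendsto (fun N : ℕ => shiftSum (x + t - N) (y + t - N)) atTop (𝓝 L') → L = L' := by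
    intro x y t hx hy hx' hy' L L' h h'
    refine le_antisymm (hle hx hy hx' hy' h h') (hle (t := -t) hx' hy' ?_ ?_ h' ?_)
    · simpa using hx
    · simpa using hy
    · simpa using h
  have habs : ∀ {x y : ℝ}, |x| ≤ 1 / 8 → |y| ≤ 1 / 8 → |y - x| ≤ 1 / 4 := fun hx hy => by
    rw [abs_le] at *; constructor <;> linarith
  obtain ⟨E, h1, h2⟩ := exists_tendsto_shiftSum (le_of_abs_le hx) (le_of_abs_le hy) (habs hx hy)
  obtain ⟨E', h1', h2'⟩ := exists_tendsto_shiftSum (le_of_abs_le hx') (le_of_abs_le hy')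
    (habs hx' hy')
  have e1 := heq hx hy hx' hy' h1 h1'
  have e2 := heq hy hx hy' hx' h2 h2'
  linarith

theorem shiftSum_neg (a : ℝ) : shiftSum (-a) a = -gaussSum (-a) a := by
  rw [shiftSum, gaussSum, ← tsum_neg]
  refine tsum_congr fun i => ?_
  rw [neg_add_cancel, neg_mul]

/-- Translation by −(x + y)/2 makes the arguments opposite, where `shiftSum_neg` and `gaussSum_eq`
apply. This is the source of the half arguments, hence of the powers of 2 in the multiplier. -/
theorem shiftSum_sub_swap {x y : ℝ} (hx : |x| ≤ 1 / 8) (hy : |y| ≤ 1 / 8) :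
    shiftSum x y - shiftSum y x = digammaSum (y - x) - digammaSum ((y - x) / 2) -
      (digammaSum (x - y) - digammaSum ((x - y) / 2)) := by
  have hx1 := abs_le.1 hx
  have hy1 := abs_le.1 hy
  have ex : x + -(x + y) / 2 = -((y - x) / 2) := by ring
  have ey : y + -(x + y) / 2 = (y - x) / 2 := by ring
  have h := shiftSum_sub_swap_eq (t := -(x + y) / 2) hx hy
    (by rw [ex, abs_le]; constructor <;> linarith) (by rw [ey, abs_le]; constructor <;> linarith)
  have h1 := shiftSum_neg ((y - x) / 2)
  have h2 := shiftSum_neg (-((y - x) / 2))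
  rw [neg_neg] at h2
  rw [h, ex, ey, h1, h2, gaussSum_eq (by linarith) (by linarith) (by linarith),
    gaussSum_eq (by linarith) (by linarith) (by linarith),
    show (y - x) / 2 - -((y - x) / 2) = y - x by ring,
    show -((y - x) / 2) - (y - x) / 2 = x - y by ring,
    show -((y - x) / 2) = (x - y) / 2 by ring]
  ring

/-! ### The evaluation of the generating series -/

theorem summable_sub_mul_pochRatio {x y X : ℝ} (hx : x ≤ 1 / 8) (hy : y ≤ 1 / 8)
    (hxy : y - x ≤ 1 / 4) (hX : X ≤ 1 / 2) :
    Summable fun i : ℕ => (1 / ((i : ℝ) + 1 - X) - 1 / (i + 1)) * pochRatio x y i := by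
  refine ((summable_pochRatio_div (p := 0) (q := X) hx hy hxy (by norm_num) hX).mul_left X).congr
    fun i => ?_
  have hi : (0 : ℝ) ≤ i := i.cast_nonneg
  have h1 : (i : ℝ) + 1 - X ≠ 0 := by linarith
  have h2 : (i : ℝ) + 1 ≠ 0 := by linarith
  rw [sub_zero]; field_simp; ring

/-- Partial fractions with 1/(i + 1 − y) inserted between the two terms. -/
theorem tsum_sub_mul_pochRatio {x y : ℝ} (hx : x ≤ 1 / 8) (hy : y ≤ 1 / 8)
    (hxy : y - x ≤ 1 / 4) (hx0 : x ≠ 0) :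
    ∑' i : ℕ, (1 / ((i : ℝ) + 1 - (x + y)) - 1 / (i + 1)) * pochRatio x y i =
      y / x * (digammaSum y - digammaSum (y - x)) - shiftSum x y := by
  have s1 := (summable_pochRatio_div (p := 0) (q := y) hx hy hxy (by norm_num)
    (by linarith)).mul_left x
  have s2 := summable_shiftSum hx hy hxy
  rw [← gaussSum_eq hx hy hxy, gaussSum, shiftSum, ← tsum_mul_left,
    ← Summable.tsum_sub (s1.mul_left _) s2]
  refine tsum_congr fun i => ?_
  have hi : (0 : ℝ) ≤ i := i.cast_nonneg
  have h1 : (i : ℝ) + 1 - (x + y) ≠ 0 := by linarith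
  have h2 : (i : ℝ) + 1 ≠ 0 := by linarith
  have h3 : (i : ℝ) + 1 - y ≠ 0 := by linarith
  rw [sub_zero]; field_simp; ring

/-! ### Truncated multiple harmonic sums -/

theorem hasSum_of_eq {ι : Type*} {f g : ι → ℝ} {a b : ℝ} (h : HasSum f a)
    (hfg : ∀ i, g i = f i) (hab : b = a) : HasSum g b := by
  rw [hab, funext hfg]
  exact h

/-- The finite sum of `1 / (m₁ ^ k₁ ⋯ m_d ^ k_d)` over `M ≥ m₁ > ⋯ > m_d > 0`. -/
noncomputable def truncMzv : ∀ {d : ℕ}, (Fin d → ℕ) → ℕ → ℝ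
  | 0, _, _ => 1
  | _ + 1, k, M => ∑ j ∈ range M, 1 / ((j : ℝ) + 1) ^ k 0 * truncMzv (Fin.tail k) j

/-- A decreasing tuple is its first entry followed by a decreasing tuple with smaller entries. -/
def consDecreasing (d : ℕ) :
    (Σ j : ℕ, {m : DecreasingTuple d // ∀ i, m.1 i ≤ j}) ≃ DecreasingTuple (d + 1) where
  toFun q := ⟨Fin.cons (q.1 + 1) q.2.1.1, by
    refine ⟨?_, fun i => ?_⟩
    · intro a b hab
      induction a using Fin.cases with
      | zero =>
        induction b using Fin.cases with
        | zero => exact absurd hab (lt_irrefl _)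
        | succ b => simpa using Nat.lt_succ_of_le (q.2.2 b)
      | succ a =>
        induction b using Fin.cases with
        | zero => exact absurd hab (Fin.not_lt_zero _)
        | succ b => simpa using q.2.1.2.1 (Fin.succ_lt_succ_iff.1 hab)
    · induction i using Fin.cases with
      | zero => simp
      | succ i => simpa using q.2.1.2.2 i⟩
  invFun m := ⟨m.1 0 - 1, ⟨⟨Fin.tail m.1, fun a b hab => m.2.1 (Fin.succ_lt_succ_iff.2 hab),
    fun i => m.2.2 i.succ⟩, fun i => Nat.le_sub_one_of_lt (m.2.1 (Fin.succ_pos i))⟩⟩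
  left_inv _ := rfl
  right_inv m := by
    apply Subtype.ext
    have := m.2.2 0
    simp only [Nat.sub_add_cancel this]
    exact Fin.cons_self_tail m.1

theorem one_div_prod_cons {d : ℕ} (k : Fin (d + 1) → ℕ) (j : ℕ)
    (m : {m : DecreasingTuple d // ∀ i, m.1 i ≤ j}) :
    1 / ∏ i, ((consDecreasing d ⟨j, m⟩).1 i : ℝ) ^ k i =
      1 / ((j : ℝ) + 1) ^ k 0 * (1 / ∏ i, (m.1.1 i : ℝ) ^ Fin.tail k i) := by
  have h0 : (consDecreasing d ⟨j, m⟩).1 0 = j + 1 := rfl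
  have hs : ∀ i : Fin d, (consDecreasing d ⟨j, m⟩).1 i.succ = m.1.1 i := fun _ => rfl
  rw [Fin.prod_univ_succ, one_div_mul_one_div]
  simp only [h0, hs, Fin.tail]
  push_cast
  rfl

/-- Induction on depth, fibring over the largest entry j + 1 with j < M; the remaining entries are
then at most j. -/
theorem hasSum_truncMzv : ∀ {d : ℕ} (k : Fin d → ℕ) (M : ℕ),
    HasSum (fun m : {m : DecreasingTuple d // ∀ i, m.1 i ≤ M} => 1 / ∏ i, (m.1.1 i : ℝ) ^ k i)
      (truncMzv k M)
  | 0, k, M => by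
    let : Unique {m : DecreasingTuple 0 // ∀ i, m.1 i ≤ M} :=
      { default := ⟨⟨Fin.elim0, fun a => a.elim0, fun a => a.elim0⟩, fun a => a.elim0⟩
        uniq := fun a => Subtype.ext (Subtype.ext (Subsingleton.elim _ _)) }
    refine hasSum_of_eq (hasSum_unique _) (fun _ => rfl) ?_
    simp [truncMzv]
  | d + 1, k, M => by
    classical
    have hsub := (hasSum_subtype_iff_indicator (s := {m : DecreasingTuple (d + 1) |
      ∀ i, m.1 i ≤ M}) (f := fun m => 1 / ∏ i, (m.1 i : ℝ) ^ k i) (a := truncMzv k M))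
    refine hsub.2 ?_
    rw [← (consDecreasing d).hasSum_iff]
    set f : (Σ j : ℕ, {m : DecreasingTuple d // ∀ i, m.1 i ≤ j}) → ℝ := fun q =>
      if q.1 ∈ range M then 1 / ((q.1 : ℝ) + 1) ^ k 0 *
        (1 / ∏ i, (q.2.1.1 i : ℝ) ^ Fin.tail k i) else 0 with hf
    have hmem : ∀ q : (Σ j : ℕ, {m : DecreasingTuple d // ∀ i, m.1 i ≤ j}),
        (consDecreasing d q ∈ {m : DecreasingTuple (d + 1) | ∀ i, m.1 i ≤ M}) ↔
          q.1 ∈ range M := by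
      rintro ⟨j, m⟩
      simp only [Set.mem_ofPred_eq, mem_range]
      constructor
      · intro h; exact h 0
      · intro h i
        induction i using Fin.cases with
        | zero => exact h
        | succ i => exact (m.2 i).trans h.le
    have hcongr : Set.indicator {m : DecreasingTuple (d + 1) | ∀ i, m.1 i ≤ M}
        (fun m => 1 / ∏ i, (m.1 i : ℝ) ^ k i) ∘ consDecreasing d = f := by
      funext q
      simp only [Function.comp, Set.indicator, hmem, hf]
      split_ifs
      · exact one_div_prod_cons k q.1 q.2
      · rfl
    rw [hcongr]
    have hnn : ∀ q, 0 ≤ f q := fun q => by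
      simp only [hf]; split_ifs
      · positivity
      · exact le_rfl
    have hfib : ∀ j, HasSum (fun m => f ⟨j, m⟩)
        (if j ∈ range M then 1 / ((j : ℝ) + 1) ^ k 0 * truncMzv (Fin.tail k) j else 0) := by
      intro j
      simp only [hf]
      split_ifs
      · exact (hasSum_truncMzv (Fin.tail k) j).mul_left _
      · exact hasSum_zero
    have hbase : HasSum (fun j => if j ∈ range M then
        1 / ((j : ℝ) + 1) ^ k 0 * truncMzv (Fin.tail k) j else 0) (truncMzv k M) := by
      have h := hasSum_sum_of_ne_finset_zero (L := .unconditional ℕ)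
        (s := range M) (f := fun j => if j ∈ range M then
        1 / ((j : ℝ) + 1) ^ k 0 * truncMzv (Fin.tail k) j else 0) (fun j hj => if_neg hj)
      rwa [sum_congr rfl fun j hj => if_pos hj] at h
    have hs : Summable f := (summable_sigma_of_nonneg hnn).2
      ⟨fun j => (hfib j).summable, hbase.summable.congr fun j => (hfib j).tsum_eq.symm⟩
    exact HasSum.sigma_of_hasSum hbase hfib hs

theorem truncMzv_nonneg : ∀ {d : ℕ} (k : Fin d → ℕ) (M : ℕ), 0 ≤ truncMzv k M
  | 0, _, _ => zero_le_one
  | _ + 1, _, _ => sum_nonneg fun j _ => mul_nonneg (by positivity) (truncMzv_nonneg _ j)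

theorem hasSum_mzv {d : ℕ} (k : Fin (d + 1) → ℕ) (h0 : 2 ≤ k 0) (h : ∀ i, 1 ≤ k i) :
    HasSum (fun j : ℕ => 1 / ((j : ℝ) + 1) ^ k 0 * truncMzv (Fin.tail k) j) (mzv k) := by
  have hs := (summable_mzv k h0 h).hasSum
  rw [← (consDecreasing d).hasSum_iff] at hs
  refine hs.sigma fun j => ?_
  exact hasSum_of_eq ((hasSum_truncMzv (Fin.tail k) j).mul_left (1 / ((j : ℝ) + 1) ^ k 0))
    (fun m => one_div_prod_cons k j m) rfl

/-! ### Sums over all exponents of given weight -/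

/-- The `d`-tuples of positive integers with sum `s`. -/
def posTuples (d s : ℕ) : Finset (Fin d → ℕ) :=
  (Finset.Nat.antidiagonalTuple d s).filter fun k => ∀ i, 1 ≤ k i

theorem mem_posTuples {d s : ℕ} {k : Fin d → ℕ} :
    k ∈ posTuples d s ↔ ∑ i, k i = s ∧ ∀ i, 1 ≤ k i := by
  rw [posTuples, mem_filter, Finset.Nat.mem_antidiagonalTuple]

/-- Splits off the first exponent; b = 1 serves the truncated sums and b = 2 the convergence
condition on k₁. -/
theorem sum_filter_antidiagonalTuple_succ {A : Type*} [AddCommMonoid A] (d s b : ℕ) (hb : 1 ≤ b)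
    (f : ℕ → (Fin d → ℕ) → A) :
    ∑ k ∈ (Finset.Nat.antidiagonalTuple (d + 1) s).filter fun k => b ≤ k 0 ∧ ∀ i, 1 ≤ k i,
        f (k 0) (Fin.tail k) =
      ∑ p ∈ antidiagonal s, if b ≤ p.1 then ∑ k ∈ posTuples d p.2, f p.1 k else 0 := by
  rw [← sum_filter, sum_sigma']
  refine sum_bij' (fun k _ => ⟨(k 0, ∑ i, Fin.tail k i), Fin.tail k⟩)
    (fun q _ => Fin.cons q.1.1 q.2) ?_ ?_ ?_ ?_ ?_
  · intro k hk
    rw [mem_filter, Finset.Nat.mem_antidiagonalTuple, Fin.sum_univ_succ] at hk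
    rw [mem_sigma, mem_filter, HasAntidiagonal.mem_antidiagonal, mem_posTuples]
    exact ⟨⟨hk.1, hk.2.1⟩, rfl, fun i => hk.2.2 i.succ⟩
  · rintro ⟨⟨a, c⟩, k⟩ hq
    rw [mem_sigma, mem_filter, HasAntidiagonal.mem_antidiagonal, mem_posTuples] at hq
    rw [mem_filter, Finset.Nat.mem_antidiagonalTuple, Fin.sum_univ_succ]
    obtain ⟨⟨h1, h2⟩, h3, h4⟩ := hq
    simp only at h1 h2 h3 h4
    refine ⟨by simp [h3, h1], by simpa using h2, fun i => ?_⟩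
    induction i using Fin.cases with
    | zero => simpa using hb.trans h2
    | succ i => simpa using h4 i
  · intro k _
    exact Fin.cons_self_tail k
  · rintro ⟨⟨a, c⟩, k⟩ hq
    rw [mem_sigma, mem_filter, HasAntidiagonal.mem_antidiagonal, mem_posTuples] at hq
    obtain ⟨_, h3, _⟩ := hq
    simp only at h3
    simp [Fin.tail_cons, h3]
  · intro k _
    rfl

/-- The sum of the truncated harmonic sums over the exponents of depth `d` and weight `s`. -/
noncomputable def weightSum (d s M : ℕ) : ℝ := ∑ k ∈ posTuples d s, truncMzv k M

theorem weightSum_zero (s M : ℕ) : weightSum 0 s M = if s = 0 then 1 else 0 := by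
  rw [weightSum, posTuples]
  cases s with
  | zero => simp [truncMzv]
  | succ s => simp

theorem weightSum_succ (d s M : ℕ) : weightSum (d + 1) s M =
    ∑ j ∈ range M, ∑ p ∈ antidiagonal s,
      (if 1 ≤ p.1 then 1 / ((j : ℝ) + 1) ^ p.1 else 0) * weightSum d p.2 j := by
  have h : posTuples (d + 1) s =
      (Finset.Nat.antidiagonalTuple (d + 1) s).filter fun k => 1 ≤ k 0 ∧ ∀ i, 1 ≤ k i :=
    filter_congr fun k _ => ⟨fun h => ⟨h 0, h⟩, fun h => h.2⟩
  rw [weightSum, h]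
  simp only [truncMzv]
  rw [sum_comm]
  refine sum_congr rfl fun j _ => ?_
  rw [sum_filter_antidiagonalTuple_succ d s 1 le_rfl
    (fun a k => 1 / ((j : ℝ) + 1) ^ a * truncMzv k j)]
  refine sum_congr rfl fun p _ => ?_
  split_ifs
  · rw [weightSum, mul_sum]
  · rw [zero_mul]

theorem weightSum_nonneg (d s M : ℕ) : 0 ≤ weightSum d s M :=
  sum_nonneg fun k _ => truncMzv_nonneg k M

/-- This makes the truncated subtraction in exponents such as s − d harmless. -/
theorem weightSum_eq_zero {d s : ℕ} (h : s < d) (M : ℕ) : weightSum d s M = 0 := by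
  refine sum_eq_zero fun k hk => absurd (mem_posTuples.1 hk) fun hk => ?_
  have : ∑ _i : Fin d, 1 ≤ ∑ i, k i := sum_le_sum fun i _ => hk.2 i
  rw [hk.1] at this
  simp at this
  omega

/-! ### Generating functions -/

/-- The elementary symmetric function of degree `d` in `1 / (j - Y)`, `1 ≤ j ≤ M`. -/
noncomputable def esymmSum (Y : ℝ) : ℕ → ℕ → ℝ
  | 0, _ => 1
  | d + 1, M => ∑ j ∈ range M, 1 / ((j : ℝ) + 1 - Y) * esymmSum Y d j

theorem esymmSum_nonneg {Y : ℝ} (hY : Y ≤ 1 / 2) : ∀ d M : ℕ, 0 ≤ esymmSum Y d M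
  | 0, _ => zero_le_one
  | d + 1, M => sum_nonneg fun j _ => by
    have : (0 : ℝ) ≤ j := j.cast_nonneg
    exact mul_nonneg (one_div_nonneg.2 (by linarith)) (esymmSum_nonneg hY d j)

theorem hasSum_geometric_shift {Y : ℝ} (hY0 : 0 ≤ Y) (hY : Y ≤ 1 / 2) (j b : ℕ) (hb : 1 ≤ b) :
    HasSum (fun k : ℕ => if b ≤ k then Y ^ (k - 1) * (1 / ((j : ℝ) + 1) ^ k) else 0)
      (Y ^ (b - 1) / ((j : ℝ) + 1) ^ (b - 1) * (1 / (j + 1 - Y))) := by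
  have hj : (0 : ℝ) ≤ j := j.cast_nonneg
  have hj1 : (j : ℝ) + 1 - Y ≠ 0 := by linarith
  have hj2 : (j : ℝ) + 1 ≠ 0 := by linarith
  rw [← hasSum_nat_add_iff' b]
  have h0 : ∑ k ∈ range b, (if b ≤ k then Y ^ (k - 1) * (1 / ((j : ℝ) + 1) ^ k) else 0) = 0 :=
    sum_eq_zero fun k hk => if_neg (by rw [mem_range] at hk; omega)
  rw [h0, sub_zero]
  have hg := (hasSum_geometric_of_lt_one (r := Y / (j + 1)) (by positivity)
    (by rw [div_lt_one (by linarith)]; linarith)).mul_left (Y ^ (b - 1) / ((j : ℝ) + 1) ^ b)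
  obtain ⟨b, rfl⟩ := Nat.exists_eq_add_of_le' hb
  refine hasSum_of_eq hg (fun k => ?_) ?_
  · rw [if_pos (by omega), show k + (b + 1) - 1 = k + b by omega, Nat.add_sub_cancel, div_pow]
    field_simp
    ring
  · rw [Nat.add_sub_cancel]
    have : 1 - Y / ((j : ℝ) + 1) = (j + 1 - Y) / (j + 1) := by field_simp
    rw [this, inv_div]
    field_simp
    ring

theorem hasSum_mul_antidiagonal {f g : ℕ → ℝ} {a b : ℝ} (hf : HasSum f a) (hg : HasSum g b)
    (hf0 : ∀ i, 0 ≤ f i) (hg0 : ∀ i, 0 ≤ g i) :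
    HasSum (fun n => ∑ p ∈ antidiagonal n, f p.1 * g p.2) (a * b) := by
  have h := hf.summable.mul_of_nonneg hg.summable hf0 hg0
  have hs := summable_sum_mul_antidiagonal_of_summable_mul h
  have := hf.summable.tsum_mul_tsum_eq_tsum_sum_antidiagonal hg.summable h
  rw [hf.tsum_eq, hg.tsum_eq] at this
  rw [this]
  exact hs.hasSum

/-- Each exponent k ≥ 1 contributes ∑ Y^(k−1)/m^k = 1/(m − Y); the Cauchy product performs this one
exponent at a time. -/
theorem hasSum_weightSum {Y : ℝ} (hY0 : 0 ≤ Y) (hY : Y ≤ 1 / 2) : ∀ d M : ℕ,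
    HasSum (fun s => weightSum d s M * Y ^ (s - d)) (esymmSum Y d M)
  | 0, M => by
    have : (fun s => weightSum 0 s M * Y ^ (s - 0)) = fun s => if s = 0 then (1 : ℝ) else 0 := by
      funext s
      rw [weightSum_zero]
      split_ifs with h
      · simp [h]
      · simp
    rw [this]
    exact hasSum_ite_eq 0 1
  | d + 1, M => by
    have h := hasSum_sum (s := range M) fun j _ => hasSum_mul_antidiagonal
      (hasSum_geometric_shift hY0 hY j 1 le_rfl) (hasSum_weightSum hY0 hY d j)
      (fun k => by split_ifs <;> positivity)
      (fun s => mul_nonneg (weightSum_nonneg _ _ _) (by positivity))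
    refine hasSum_of_eq h (fun s => ?_) ?_
    · rw [weightSum_succ, sum_mul]
      refine sum_congr rfl fun j _ => ?_
      rw [sum_mul]
      refine sum_congr rfl fun p hp => ?_
      rw [HasAntidiagonal.mem_antidiagonal] at hp
      by_cases h1 : 1 ≤ p.1
      · rw [if_pos h1, if_pos h1]
        by_cases h2 : d ≤ p.2
        · rw [show s - (d + 1) = (p.1 - 1) + (p.2 - d) by omega, pow_add]
          ring
        · rw [weightSum_eq_zero (not_le.1 h2)]
          ring
      · rw [if_neg h1, if_neg h1]
        ring
    · simp [esymmSum]

/-- Passing from M to M + 1 adds the variable 1/(M + 1 − Y), which multiplies the generating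
function by one factor. -/
theorem hasSum_esymmSum (Y z : ℝ) (M : ℕ) :
    HasSum (fun d => z ^ d * esymmSum Y d M) (∏ j ∈ range M, (1 + z / ((j : ℝ) + 1 - Y))) := by
  induction M with
  | zero =>
    have : (fun d => z ^ d * esymmSum Y d 0) = fun d => if d = 0 then (1 : ℝ) else 0 := by
      funext d
      cases d <;> simp [esymmSum]
    rw [this, prod_range_zero]
    exact hasSum_ite_eq 0 1
  | succ M ih =>
    have h1 : HasSum (fun d => z ^ (d + 1) * esymmSum Y (d + 1) (M + 1))
        ((∏ j ∈ range (M + 1), (1 + z / ((j : ℝ) + 1 - Y))) - 1) := by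
      have h2 := (hasSum_nat_add_iff' 1).2 ih
      have h3 := h2.add (ih.mul_left (z / ((M : ℝ) + 1 - Y)))
      refine hasSum_of_eq h3 (fun d => ?_) ?_
      · simp only [esymmSum, sum_range_succ]
        ring
      · rw [prod_range_succ]
        simp [esymmSum]
        ring
    have h4 := (hasSum_nat_add_iff (f := fun d => z ^ d * esymmSum Y d (M + 1)) 1).1 h1
    simpa [esymmSum] using h4

/-! ### The weighted sums as coefficients -/

/-- The real version of `S`. -/
noncomputable def realS (l : ℕ) : ℕ → ℝ → ℝ → ℝ
  | 0, _, _ => 0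
  | d + 1, x, y => ∑ k ∈ admissibleIndices l d, x ^ (k 0 - 1) * y ^ (l - k 0 - d) * mzv k

theorem S_ofReal (l n : ℕ) (x y : ℝ) : S l n (x : ℂ) (y : ℂ) = (realS l n x y : ℂ) := by
  cases n with
  | zero => simp [S, realS]
  | succ d => simp [S, realS]

theorem mem_admissibleIndices {l d : ℕ} {k : Fin (d + 1) → ℕ} :
    k ∈ admissibleIndices l d ↔ ∑ i, k i = l ∧ 2 ≤ k 0 ∧ ∀ i, 1 ≤ k i := by
  rw [admissibleIndices, mem_filter, Finset.Nat.mem_antidiagonalTuple]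

theorem add_le_of_mem_admissibleIndices {l d : ℕ} {k : Fin (d + 1) → ℕ}
    (hk : k ∈ admissibleIndices l d) : k 0 + d ≤ l := by
  obtain ⟨h1, _, h3⟩ := mem_admissibleIndices.1 hk
  rw [Fin.sum_univ_succ] at h1
  have : ∑ _i : Fin d, 1 ≤ ∑ i : Fin d, k i.succ := sum_le_sum fun i _ => h3 i.succ
  simp at this
  omega

theorem realS_eq_zero {l d : ℕ} (h : l < d + 2) (x y : ℝ) : realS l (d + 1) x y = 0 := by
  refine sum_eq_zero fun k hk => ?_
  have h1 := add_le_of_mem_admissibleIndices hk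
  have h2 := (mem_admissibleIndices.1 hk).2.1
  omega

theorem realS_smul (l n : ℕ) (t x y : ℝ) :
    realS l n (t * x) (t * y) = t ^ (l - n) * realS l n x y := by
  cases n with
  | zero => simp [realS]
  | succ d =>
    rw [realS, realS, mul_sum]
    refine sum_congr rfl fun k hk => ?_
    have h1 := add_le_of_mem_admissibleIndices hk
    have h2 := (mem_admissibleIndices.1 hk).2.1
    rw [show l - (d + 1) = (k 0 - 1) + (l - k 0 - d) by omega, pow_add, mul_pow, mul_pow]
    ring

/-- The part of the weighted sum of depth `d + 2` and weight `l` with largest summation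
variable `i + 1`. -/
noncomputable def layer (X Y : ℝ) (l d i : ℕ) : ℝ :=
  ∑ p ∈ antidiagonal l, (if 2 ≤ p.1 then X ^ (p.1 - 1) * (1 / ((i : ℝ) + 1) ^ p.1) else 0) *
    (weightSum (d + 1) p.2 i * Y ^ (p.2 - (d + 1)))

theorem layer_nonneg {X Y : ℝ} (hX : 0 ≤ X) (hY : 0 ≤ Y) (l d i : ℕ) : 0 ≤ layer X Y l d i :=
  sum_nonneg fun p _ => mul_nonneg (by split_ifs <;> positivity)
    (mul_nonneg (weightSum_nonneg _ _ _) (by positivity))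

theorem hasSum_layer (X Y : ℝ) (l d : ℕ) :
    HasSum (fun i => layer X Y l d i) (realS l (d + 2) X Y) := by
  have h := hasSum_sum (s := admissibleIndices l (d + 1)) fun k hk =>
    (hasSum_mzv k (mem_admissibleIndices.1 hk).2.1 (mem_admissibleIndices.1 hk).2.2).mul_left
      (X ^ (k 0 - 1) * Y ^ (l - k 0 - (d + 1)))
  refine hasSum_of_eq h (fun i => ?_) rfl
  rw [admissibleIndices, sum_filter_antidiagonalTuple_succ (d + 1) l 2 one_le_two
    (fun a k => X ^ (a - 1) * Y ^ (l - a - (d + 1)) * (1 / ((i : ℝ) + 1) ^ a * truncMzv k i)),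
    layer]
  refine sum_congr rfl fun p hp => ?_
  rw [HasAntidiagonal.mem_antidiagonal] at hp
  split_ifs
  · rw [← mul_sum, ← mul_sum, weightSum, show l - p.1 = p.2 by omega]
    ring
  · rw [zero_mul]

theorem hasSum_layer_weight {X Y : ℝ} (hX0 : 0 ≤ X) (hX : X ≤ 1 / 2) (hY0 : 0 ≤ Y)
    (hY : Y ≤ 1 / 2) (d i : ℕ) : HasSum (fun l => layer X Y l d i)
      ((1 / ((i : ℝ) + 1 - X) - 1 / (i + 1)) * esymmSum Y (d + 1) i) := by
  have h := hasSum_mul_antidiagonal (hasSum_geometric_shift hX0 hX i 2 one_le_two)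
    (hasSum_weightSum hY0 hY (d + 1) i) (fun k => by split_ifs <;> positivity)
    (fun s => mul_nonneg (weightSum_nonneg _ _ _) (by positivity))
  refine hasSum_of_eq h (fun l => rfl) ?_
  have hi : (0 : ℝ) ≤ i := i.cast_nonneg
  have h1 : (i : ℝ) + 1 - X ≠ 0 := by linarith
  have h2 : (i : ℝ) + 1 ≠ 0 := by linarith
  congr 1
  simp only [Nat.add_one_sub_one, pow_one]
  field_simp
  ring

theorem hasSum_esymmSum_succ {Y z : ℝ} (hY : Y ≤ 1 / 2) (hz : z ≠ 0) (i : ℕ) :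
    HasSum (fun d => z ^ d * esymmSum Y (d + 1) i) ((pochRatio (Y - z) Y i - 1) / z) := by
  have h := ((hasSum_nat_add_iff' 1).2 (hasSum_esymmSum Y z i)).div_const z
  refine hasSum_of_eq h (fun d => ?_) ?_
  · rw [pow_succ]; field_simp
  · have : ∏ j ∈ range i, (1 + z / ((j : ℝ) + 1 - Y)) = pochRatio (Y - z) Y i := by
      refine prod_congr rfl fun j _ => ?_
      have hj : (0 : ℝ) ≤ j := j.cast_nonneg
      have : (j : ℝ) + 1 - Y ≠ 0 := by linarith
      field_simp
      ring
    rw [this]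
    simp [esymmSum]

theorem hasSum_layer_depth {X Y z : ℝ} (hX0 : 0 ≤ X) (hX : X ≤ 1 / 2) (hY0 : 0 ≤ Y)
    (hY : Y ≤ 1 / 2) (hz : z ≠ 0) (i : ℕ) :
    HasSum (fun d => z ^ d * ∑' l, layer X Y l d i)
      ((1 / ((i : ℝ) + 1 - X) - 1 / (i + 1)) * ((pochRatio (Y - z) Y i - 1) / z)) := by
  have h := hasSum_esymmSum_succ hY hz i
  refine hasSum_of_eq (h.mul_left (1 / ((i : ℝ) + 1 - X) - 1 / (i + 1))) (fun d => ?_) rfl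
  rw [(hasSum_layer_weight hX0 hX hY0 hY d i).tsum_eq]
  ring

/-- Licenses the exchange of the sums over i, depth and weight. Layers are nonnegative, so with |z|
in place of z the inner sums are evaluated in closed form, and the outer one converges by the growth
bound. -/
theorem summable_layer {X Y z : ℝ} (hX0 : 0 ≤ X) (hX : X ≤ 1 / 2) (hY0 : 0 ≤ Y)
    (hY : Y ≤ 1 / 8) (hz : z ≠ 0) (hz' : |z| ≤ 1 / 4) :
    Summable fun q : ℕ × ℕ × ℕ => z ^ q.2.1 * layer X Y q.2.2 q.2.1 q.1 := by
  refine Summable.of_norm ?_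
  have habs : ∀ q : ℕ × ℕ × ℕ, ‖z ^ q.2.1 * layer X Y q.2.2 q.2.1 q.1‖ =
      |z| ^ q.2.1 * layer X Y q.2.2 q.2.1 q.1 := fun q => by
    rw [Real.norm_eq_abs, abs_mul, abs_pow, abs_of_nonneg (layer_nonneg hX0 hY0 _ _ _)]
  simp only [habs]
  have hz0 : 0 < |z| := abs_pos.2 hz
  have hfib : ∀ i d, HasSum (fun l => |z| ^ d * layer X Y l d i)
      (|z| ^ d * ∑' l, layer X Y l d i) := fun i d =>
    (hasSum_layer_weight hX0 hX hY0 (by linarith) d i).summable.hasSum.mul_left _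
  have hnn : ∀ l d i, 0 ≤ |z| ^ d * layer X Y l d i := fun l d i =>
    mul_nonneg (by positivity) (layer_nonneg hX0 hY0 _ _ _)
  have hs : ∀ i, Summable fun q : ℕ × ℕ => |z| ^ q.1 * layer X Y q.2 q.1 i := fun i =>
    (summable_prod_of_nonneg fun q => hnn _ _ _).2 ⟨fun d => (hfib i d).summable,
      (hasSum_layer_depth hX0 hX hY0 (by linarith) hz0.ne' i).summable.congr
        fun d => (hfib i d).tsum_eq.symm⟩
  refine (summable_prod_of_nonneg fun q => hnn _ _ _).2 ⟨hs, ?_⟩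
  have h1 : ∀ i, ∑' q : ℕ × ℕ, |z| ^ q.1 * layer X Y q.2 q.1 i =
      (1 / ((i : ℝ) + 1 - X) - 1 / (i + 1)) * ((pochRatio (Y - |z|) Y i - 1) / |z|) := fun i =>
    ((hs i).hasSum.prod_fiberwise (hfib i)).unique
      (hasSum_layer_depth hX0 hX hY0 (by linarith) hz0.ne' i)
  simp only [h1]
  refine (((summable_sub_mul_pochRatio (x := Y - |z|) (y := Y) (by linarith) hY (by linarith)
    hX).sub (summable_digammaSum hX)).div_const |z|).congr fun i => ?_
  ring

theorem sum_Icc_two {A : Type*} [AddCommMonoid A] (l : ℕ) (f : ℕ → A) :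
    ∑ n ∈ Icc 2 (l - 1), f n = ∑ d ∈ range (l - 2), f (d + 2) := by
  have : Icc 2 (l - 1) = Ico 2 l := by ext; simp; omega
  rw [this, sum_Ico_eq_sum_range]
  simp only [add_comm]

theorem hasSum_depth (X Y z : ℝ) (l : ℕ) : HasSum (fun d => z ^ d * realS l (d + 2) X Y)
    (∑ n ∈ Icc 2 (l - 1), z ^ (n - 2) * realS l n X Y) := by
  rw [sum_Icc_two]
  refine hasSum_sum_of_ne_finset_zero fun d hd => ?_
  rw [mem_range] at hd
  rw [realS_eq_zero (by omega), mul_zero]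

/-- The triple family is summed in two orders: weight, depth, then largest variable gives the closed
form; largest variable, depth, then weight gives the weighted sums. -/
theorem hasSum_generating {X Y z : ℝ} (hX0 : 0 ≤ X) (hX : X ≤ 1 / 2) (hY0 : 0 ≤ Y)
    (hY : Y ≤ 1 / 8) (hz : z ≠ 0) (hz' : |z| ≤ 1 / 4) (hYz : Y - z ≤ 1 / 8) :
    HasSum (fun l => ∑ n ∈ Icc 2 (l - 1), z ^ (n - 2) * realS l n X Y)
      (1 / z * ((∑' i : ℕ, (1 / ((i : ℝ) + 1 - X) - 1 / (i + 1)) * pochRatio (Y - z) Y i) -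
        digammaSum X)) := by
  have hs := summable_layer hX0 hX hY0 hY hz hz'
  have h1 : ∀ i, HasSum (fun q : ℕ × ℕ => z ^ q.1 * layer X Y q.2 q.1 i)
      ((1 / ((i : ℝ) + 1 - X) - 1 / (i + 1)) * ((pochRatio (Y - z) Y i - 1) / z)) := fun i => by
    have h := (hs.prod_factor i).hasSum
    have h' := h.prod_fiberwise fun d =>
      (hasSum_layer_weight hX0 hX hY0 (by linarith) d i).summable.hasSum.mul_left (z ^ d)
    rw [← h'.unique (hasSum_layer_depth hX0 hX hY0 (by linarith) hz i)]
    exact h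
  have h2 := hs.hasSum.prod_fiberwise h1
  have h3 : HasSum (fun i : ℕ =>
      (1 / ((i : ℝ) + 1 - X) - 1 / (i + 1)) * ((pochRatio (Y - z) Y i - 1) / z))
      (1 / z * ((∑' i : ℕ, (1 / ((i : ℝ) + 1 - X) - 1 / (i + 1)) * pochRatio (Y - z) Y i) -
        digammaSum X)) := by
    refine hasSum_of_eq (((summable_sub_mul_pochRatio (x := Y - z) (y := Y) hYz hY
      (by linarith [le_abs_self z]) hX).hasSum.sub (summable_digammaSum hX).hasSum).mul_left
        (1 / z)) (fun i => ?_) rfl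
    ring
  let e : ℕ × ℕ × ℕ ≃ ℕ × ℕ × ℕ :=
    ⟨fun q => (q.2.2, q.2.1, q.1), fun q => (q.2.2, q.2.1, q.1), fun _ => rfl, fun _ => rfl⟩
  have h4 := e.hasSum_iff.2 hs.hasSum
  rw [← h3.unique h2] at h4
  have h5 : ∀ l, HasSum (fun q : ℕ × ℕ => z ^ q.1 * layer X Y l q.1 q.2)
      (∑ n ∈ Icc 2 (l - 1), z ^ (n - 2) * realS l n X Y) := fun l => by
    have h := (h4.summable.prod_factor l).hasSum
    have h' := h.prod_fiberwise fun d => (hasSum_layer X Y l d).mul_left (z ^ d)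
    rw [(hasSum_depth X Y z l).unique h']
    exact h
  exact h4.prod_fiberwise h5

/-! ### Zeta values -/

/-- The real number `ζ(l)`. -/
noncomputable def realZeta (l : ℕ) : ℝ := ∑' i : ℕ, 1 / ((i : ℝ) + 1) ^ l

theorem riemannZeta_natCast {l : ℕ} (hl : 2 ≤ l) : riemannZeta (l : ℂ) = (realZeta l : ℂ) := by
  rw [zeta_nat_eq_tsum_of_gt_one (by omega), realZeta, Complex.ofReal_tsum]
  have hs : Summable fun n : ℕ => 1 / (n : ℂ) ^ l := by
    have := Complex.summable_one_div_nat_cpow.2 (show 1 < ((l : ℂ)).re by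
      rw [Complex.natCast_re]; exact_mod_cast hl)
    simpa using this
  rw [hs.tsum_eq_zero_add]
  have : l ≠ 0 := by omega
  simp [this]

/-- Expand 1/(m − z) − 1/m geometrically and exchange the sums; absolute convergence is the same
computation at |z|. -/
theorem hasSum_pow_mul_realZeta {z : ℝ} (hz : |z| ≤ 1 / 2) :
    HasSum (fun j : ℕ => z ^ (j + 1) * realZeta (j + 2)) (digammaSum z) := by
  have hgeom : ∀ w : ℝ, |w| ≤ 1 / 2 → ∀ i : ℕ, HasSum
      (fun j : ℕ => w ^ (j + 1) * (1 / ((i : ℝ) + 1) ^ (j + 2)))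
      (1 / ((i : ℝ) + 1 - w) - 1 / (i + 1)) := by
    intro w hw i
    have hi : (0 : ℝ) ≤ i := i.cast_nonneg
    have hw' := le_of_abs_le hw
    have hi1 : (i : ℝ) + 1 - w ≠ 0 := by linarith
    have hi2 : (0 : ℝ) < (i : ℝ) + 1 := by linarith
    have hlt : |w / ((i : ℝ) + 1)| < 1 := by
      rw [abs_div, abs_of_pos hi2, div_lt_one hi2]; linarith
    refine hasSum_of_eq ((hasSum_geometric_of_abs_lt_one hlt).mul_left
      (w / ((i : ℝ) + 1) ^ 2)) (fun j => ?_) ?_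
    · rw [div_pow, pow_add, pow_add, pow_one]; field_simp
    · have : 1 - w / ((i : ℝ) + 1) = (i + 1 - w) / (i + 1) := by field_simp
      rw [this, inv_div]
      field_simp
      ring
  have hs : Summable fun q : ℕ × ℕ => z ^ (q.2 + 1) * (1 / ((q.1 : ℝ) + 1) ^ (q.2 + 2)) := by
    refine Summable.of_norm ?_
    have habs : ∀ q : ℕ × ℕ, ‖z ^ (q.2 + 1) * (1 / ((q.1 : ℝ) + 1) ^ (q.2 + 2))‖ =
        |z| ^ (q.2 + 1) * (1 / ((q.1 : ℝ) + 1) ^ (q.2 + 2)) := fun q => by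
      rw [Real.norm_eq_abs, abs_mul, abs_pow, abs_of_nonneg (by positivity :
        0 ≤ 1 / ((q.1 : ℝ) + 1) ^ (q.2 + 2))]
    simp only [habs]
    have hz2 : |(|z|)| ≤ 1 / 2 := by rwa [abs_abs]
    exact (summable_prod_of_nonneg fun q => by simp only [Pi.zero_apply]; positivity).2
      ⟨fun i => (hgeom |z| hz2 i).summable, (summable_digammaSum (le_of_abs_le hz2)).congr
        fun i => (hgeom |z| hz2 i).tsum_eq.symm⟩
  have h1 := hs.hasSum.prod_fiberwise (hgeom z hz)
  have h2 := (Equiv.prodComm ℕ ℕ).hasSum_iff.2 hs.hasSum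
  rw [← h1.tsum_eq] at h2
  refine h2.prod_fiberwise fun j => ?_
  refine Summable.hasSum_iff ?_ |>.2 ?_
  · exact h2.summable.prod_factor j
  · simp only [Function.comp, Equiv.prodComm_apply, Prod.swap]
    rw [tsum_mul_left, realZeta]

/-! ### The identity for small real arguments -/

/-- The weighted double sum, for real arguments. -/
noncomputable def realLHS (l : ℕ) (x y : ℝ) : ℝ :=
  ∑ n ∈ Icc 2 (l - 1), (y - x) ^ (n - 2) *
    (realS l n (x + y) y + (-1) ^ n * realS l n (y + x) x)

/-- The multiplier of `ζ(l)`, off its removable singularities. -/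
noncomputable def multiplier {K : Type*} [Field K] (l : ℕ) (x y : K) : K :=
  (y ^ (l + 1) - x ^ (l + 1)) / (y * x * (y - x)) - (y - x) ^ (l - 2) *
    ((1 + (-1) ^ l) * ((2 ^ (l - 1) - 1) / 2 ^ (l - 1)) + (-1) ^ l * (x / y) + y / x)

theorem realLHS_smul (l : ℕ) (t x y : ℝ) :
    realLHS l (t * x) (t * y) = t ^ (l - 2) * realLHS l x y := by
  rw [realLHS, realLHS, mul_sum]
  refine sum_congr rfl fun n hn => ?_
  rw [mem_Icc] at hn
  rw [← mul_add, ← mul_add, realS_smul, realS_smul, ← mul_sub, mul_pow,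
    show l - 2 = (n - 2) + (l - n) by omega, pow_add]
  ring

theorem multiplier_smul {l : ℕ} (hl : 2 ≤ l) {t x y : ℝ} (ht : t ≠ 0) (hx : x ≠ 0) (hy : y ≠ 0)
    (hxy : x ≠ y) : multiplier l (t * x) (t * y) = t ^ (l - 2) * multiplier l x y := by
  have h1 : y - x ≠ 0 := sub_ne_zero.2 hxy.symm
  obtain ⟨j, rfl⟩ := Nat.exists_eq_add_of_le' hl
  rw [multiplier, multiplier, mul_div_mul_left _ _ ht, mul_div_mul_left _ _ ht, ← mul_sub t y x,
    Nat.add_sub_cancel, mul_pow t (y - x), mul_sub (t ^ j), ← mul_assoc (t ^ j)]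
  congr 1
  field_simp
  ring

/-- The sign (−1)^n turns (y − x)^(n−2) into (x − y)^(n−2), so the second half is the generating
series with x and y exchanged; the two copies of `digammaSum (x + y)` cancel. -/
theorem hasSum_realLHS {x y : ℝ} (hx : 0 < x) (hxy : x < y) (hy : y ≤ 1 / 8) :
    HasSum (fun l => realLHS l x y) (1 / (y - x) *
      ((∑' i : ℕ, (1 / ((i : ℝ) + 1 - (x + y)) - 1 / (i + 1)) * pochRatio x y i) -
        ∑' i : ℕ, (1 / ((i : ℝ) + 1 - (y + x)) - 1 / (i + 1)) * pochRatio y x i)) := by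
  have h1 := hasSum_generating (X := x + y) (Y := y) (z := y - x) (by linarith) (by linarith)
    (by linarith) hy (by linarith) (by rw [abs_le]; constructor <;> linarith) (by linarith)
  have h2 := hasSum_generating (X := y + x) (Y := x) (z := x - y) (by linarith) (by linarith)
    (by linarith) (by linarith) (by linarith) (by rw [abs_le]; constructor <;> linarith)
    (by linarith)
  rw [show y - (y - x) = x by ring] at h1
  rw [show x - (x - y) = y by ring] at h2
  have e1 : y - x ≠ 0 := by linarith
  have e2 : x - y ≠ 0 := by linarith
  refine hasSum_of_eq (h1.add h2) (fun l => ?_) ?_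
  · rw [realLHS, ← sum_add_distrib]
    refine sum_congr rfl fun n hn => ?_
    rw [mem_Icc] at hn
    have : (x - y) ^ (n - 2) = (-1) ^ n * (y - x) ^ (n - 2) := by
      rw [← neg_sub y x, neg_pow]
      congr 1
      rw [show n = n - 2 + 2 by omega, pow_add]
      simp
    rw [this]
    ring
  · rw [← neg_sub y x, add_comm y x, one_div_neg_eq_neg_one_div]
    ring

theorem hasSum_multiplier {x y : ℝ} (hx : 0 < x) (hxy : x < y) (hy : y ≤ 1 / 8) :
    HasSum (fun j : ℕ => multiplier (j + 2) x y * realZeta (j + 2)) (1 / (y - x) *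
      (y / x * (digammaSum y - digammaSum (y - x)) - x / y * (digammaSum x - digammaSum (x - y)) -
      (digammaSum (y - x) - digammaSum (x - y) - digammaSum ((y - x) / 2) +
        digammaSum ((x - y) / 2)))) := by
  have T : ∀ z : ℝ, -(1 / 8) ≤ z → z ≤ 1 / 8 →
      HasSum (fun j : ℕ => z ^ (j + 1) * realZeta (j + 2)) (digammaSum z) := fun z h1 h2 =>
    hasSum_pow_mul_realZeta (abs_le.2 ⟨by linarith, by linarith⟩)
  have t1 := T y (by linarith) (by linarith)
  have t2 := T x (by linarith) (by linarith)
  have t3 := T (y - x) (by linarith) (by linarith)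
  have t4 := T (x - y) (by linarith) (by linarith)
  have t5 := T ((y - x) / 2) (by linarith) (by linarith)
  have t6 := T ((x - y) / 2) (by linarith) (by linarith)
  refine hasSum_of_eq (((((t1.sub t3).mul_left (y / x)).sub ((t2.sub t4).mul_left (x / y))).sub
    (((t3.sub t4).sub t5).add t6)).mul_left (1 / (y - x))) (fun j => ?_) rfl
  have e1 : y - x ≠ 0 := by linarith
  have e2 : y ≠ 0 := by linarith
  have e3 : (x - y) ^ (j + 1) = -((-1) ^ j * ((y - x) ^ j * (y - x))) := by
    rw [← neg_sub y x, neg_pow]; ring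
  have e4 : (2 : ℝ) ^ j ≠ 0 := by positivity
  rw [multiplier, div_pow, div_pow, e3, show j + 2 - 2 = j by omega,
    show j + 2 - 1 = j + 1 by omega, show (-1 : ℝ) ^ (j + 2) = (-1) ^ j by rw [pow_add]; simp,
    pow_succ (y - x) j, pow_succ (2 : ℝ) j]
  generalize (-1 : ℝ) ^ j = s
  generalize (y - x) ^ j = a
  field_simp
  ring

/-- The weights 0 and 1 contribute only empty sums, so both series may start at l = 2. -/
theorem hasSum_realLHS_sub {x y : ℝ} (hx : 0 < x) (hxy : x < y) (hy : y ≤ 1 / 8) :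
    HasSum (fun j : ℕ => realLHS (j + 2) x y - multiplier (j + 2) x y * realZeta (j + 2)) 0 := by
  have h1 := (hasSum_nat_add_iff' 2).2 (hasSum_realLHS hx hxy hy)
  have h0 : ∑ l ∈ range 2, realLHS l x y = 0 := by
    simp [sum_range_succ, realLHS]
  rw [h0, sub_zero] at h1
  refine hasSum_of_eq (h1.sub (hasSum_multiplier hx hxy hy)) (fun _ => rfl) ?_
  have hs := shiftSum_sub_swap (x := x) (y := y) (by rw [abs_le]; constructor <;> linarith)
    (by rw [abs_le]; constructor <;> linarith)
  rw [tsum_sub_mul_pochRatio (by linarith) hy (by linarith) hx.ne',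
    tsum_sub_mul_pochRatio hy (by linarith) (by linarith) (by linarith), ← mul_sub]
  symm
  apply mul_eq_zero_of_right
  linarith

/-! ### Comparison of coefficients -/

/-- If the earlier coefficients vanish, dividing by t^n gives |c n| ≤ t·C, and t tends to 0. Only 0
< t ≤ 1 is required, since scaling by such t preserves 0 < x < y ≤ 1/8. -/
theorem eq_zero_of_hasSum_pow_mul {c : ℕ → ℝ}
    (h : ∀ t : ℝ, 0 < t → t ≤ 1 → HasSum (fun j => t ^ j * c j) 0) (n : ℕ) : c n = 0 := by
  have hsum : Summable fun j => |c j| := by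
    simpa using (h 1 one_pos le_rfl).summable.abs
  induction n using Nat.strong_induction_on with
  | _ n ih =>
    set C := ∑' j, |c (j + (n + 1))| with hC
    have hsC : Summable fun j => |c (j + (n + 1))| := 
      (summable_nat_add_iff (f := fun j => |c j|) (n + 1)).2 hsum
    have key : ∀ t : ℝ, 0 < t → t ≤ 1 → |c n| ≤ t * C := by
      intro t ht0 ht1
      have h1 := (hasSum_nat_add_iff' (n + 1)).2 (h t ht0 ht1)
      rw [sum_range_succ, sum_eq_zero fun k hk => by rw [ih k (mem_range.1 hk), mul_zero],
        zero_add, zero_sub] at h1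
      have h2 : ∀ j, ‖t ^ (j + (n + 1)) * c (j + (n + 1))‖ ≤ t ^ (n + 1) * |c (j + (n + 1))| := by
        intro j
        rw [norm_mul, Real.norm_eq_abs, Real.norm_eq_abs, 
          abs_of_pos (by positivity : 0 < t ^ (j + (n + 1))), pow_add]
        exact mul_le_mul_of_nonneg_right (mul_le_of_le_one_left (by positivity)
          (pow_le_one₀ ht0.le ht1)) (abs_nonneg _)
      have h3 := tsum_of_norm_bounded (hsC.hasSum.mul_left (t ^ (n + 1))) h2
      rw [h1.tsum_eq, norm_neg, norm_mul, Real.norm_eq_abs, Real.norm_eq_abs,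
        abs_of_pos (by positivity : 0 < t ^ n), pow_succ, mul_assoc] at h3
      exact le_of_mul_le_mul_left h3 (by positivity)
    have hlim : Tendsto (fun N : ℕ => 1 / ((N : ℝ) + 1) * C) atTop (𝓝 (0 * C)) :=
      tendsto_one_div_add_atTop_nhds_zero_nat.mul_const C
    rw [zero_mul] at hlim
    have : |c n| ≤ 0 := ge_of_tendsto' hlim fun N =>
      key _ (by positivity) (by rw [div_le_one (by positivity)]; linarith [N.cast_nonneg (α := ℝ)])
    exact abs_nonpos_iff.1 this

theorem realLHS_eq {l : ℕ} (hl : 2 ≤ l) {x y : ℝ} (hx : 0 < x) (hxy : x < y) (hy : y ≤ 1 / 8) :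
    realLHS l x y = multiplier l x y * realZeta l := by
  obtain ⟨j, rfl⟩ := Nat.exists_eq_add_of_le' hl
  refine sub_eq_zero.1 (eq_zero_of_hasSum_pow_mul (c := fun j : ℕ =>
    realLHS (j + 2) x y - multiplier (j + 2) x y * realZeta (j + 2)) (fun t ht0 ht1 => ?_) j)
  have hty : t * y ≤ y := mul_le_of_le_one_left (by linarith) ht1
  refine hasSum_of_eq (hasSum_realLHS_sub (x := t * x) (y := t * y) (by positivity)
    (mul_lt_mul_of_pos_left hxy ht0) (by linarith)) (fun j => ?_) rfl
  rw [realLHS_smul, multiplier_smul (by omega) ht0.ne' hx.ne' (by linarith) hxy.ne,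
    Nat.add_sub_cancel]
  ring

/-! ### Extension to all complex arguments -/

/-- The polynomial in `x, y` that the multiplier of `ζ(l)` is. -/
noncomputable def multiplierPoly {R : Type*} [CommRing R] (c : R) (l : ℕ) (x y : R) : R :=
  ∑ i ∈ range (l - 1), y ^ i * x ^ (l - 2 - i) - c * (y - x) ^ (l - 2) +
    y * ∑ i ∈ range (l - 2), (y - x) ^ i * y ^ (l - 3 - i) -
    (-1) ^ l * (x * ∑ i ∈ range (l - 2), (y - x) ^ i * (-x) ^ (l - 3 - i))

/-- The quotient of powers is the first geometric sum plus y^(l−1)/x and x^(l−1)/y. These poles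
cancel against those of the other terms because (y − x)^(l−2) − y^(l−2) is divisible by x and (y −
x)^(l−2) − (−x)^(l−2) by y. -/
theorem multiplierPoly_eq {l : ℕ} (hl : 3 ≤ l) {x y : ℂ} (hx : x ≠ 0) (hy : y ≠ 0)
    (hxy : x ≠ y) : multiplierPoly ((1 + (-1) ^ l) * ((2 ^ (l - 1) - 1) / 2 ^ (l - 1))) l x y =
      multiplier l x y := by
  have h1 : y - x ≠ 0 := sub_ne_zero.2 hxy.symm
  obtain ⟨m, rfl⟩ := Nat.exists_eq_add_of_le' hl
  rw [multiplierPoly, multiplier]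
  generalize (1 + (-1 : ℂ) ^ (m + 3)) * ((2 ^ (m + 3 - 1) - 1) / 2 ^ (m + 3 - 1)) = c
  simp only [show m + 3 - 1 = m + 2 by omega, show m + 3 - 2 = m + 1 by omega,
    Nat.add_sub_cancel]
  have g1 : (∑ i ∈ range (m + 2), y ^ i * x ^ (m + 1 - i)) * (y - x) = y ^ (m + 2) - x ^ (m + 2) :=
    (Commute.all y x).geom_sum₂_mul (m + 2)
  have g2 : (∑ i ∈ range (m + 1), (y - x) ^ i * y ^ (m - i)) * (y - x - y) =
      (y - x) ^ (m + 1) - y ^ (m + 1) := (Commute.all _ _).geom_sum₂_mul (m + 1)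
  have g3 : (∑ i ∈ range (m + 1), (y - x) ^ i * (-x) ^ (m - i)) * (y - x - -x) =
      (y - x) ^ (m + 1) - (-x) ^ (m + 1) := (Commute.all _ _).geom_sum₂_mul (m + 1)
  rw [← eq_div_iff h1] at g1
  rw [← eq_div_iff (by simpa using hx)] at g2
  rw [← eq_div_iff (by simpa using hy)] at g3
  rw [g1, g2, g3, neg_pow x]
  have hs : (-1 : ℂ) ^ (m + 1) * (-1) ^ (m + 1) = 1 := by rw [← mul_pow]; simp
  rw [show m + 3 = (m + 1) + 2 by omega, show (-1 : ℂ) ^ (m + 1 + 2) = (-1) ^ (m + 1) by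
    rw [pow_add _ _ 2]; simp]
  generalize (-1 : ℂ) ^ (m + 1) = s at hs
  generalize (y - x) ^ (m + 1) = a
  rw [sub_sub_cancel_left, sub_neg_eq_add, sub_add_cancel]
  field_simp
  linear_combination x ^ (m + 3) * (y - x) * hs

theorem multiplierPoly_one_one {l : ℕ} (hl : 3 ≤ l) (c : ℂ) :
    multiplierPoly c l 1 1 = (l : ℂ) + 1 := by
  obtain ⟨m, rfl⟩ := Nat.exists_eq_add_of_le' hl
  have h0 : ∀ f : ℕ → ℂ, ∑ i ∈ range (m + 1), (0 : ℂ) ^ i * f i = f 0 := fun f => by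
    rw [sum_range_succ']; simp
  have hs : (-1 : ℂ) ^ (m + 3) * (-1) ^ m = -1 := by
    rw [← pow_add, show m + 3 + m = 2 * (m + 1) + 1 by ring, pow_succ, pow_mul]; simp
  simp only [multiplierPoly, show m + 3 - 1 = m + 2 by omega, show m + 3 - 2 = m + 1 by omega,
    Nat.add_sub_cancel, sub_self]
  rw [h0 fun i => 1 ^ (m - i), h0 fun i => (-1) ^ (m - i)]
  simp only [Nat.sub_zero, one_mul, hs]
  simp
  ring

/-- The polynomial form of `S`, at polynomial arguments. -/
noncomputable def polyS (l : ℕ) : ℕ → MvPolynomial (Fin 2) ℂ → MvPolynomial (Fin 2) ℂ →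
    MvPolynomial (Fin 2) ℂ
  | 0, _, _ => 0
  | d + 1, p, q => ∑ k ∈ admissibleIndices l d,
      p ^ (k 0 - 1) * q ^ (l - k 0 - d) * MvPolynomial.C (mzv k : ℂ)

theorem eval_polyS (l n : ℕ) (p q : MvPolynomial (Fin 2) ℂ) (v : Fin 2 → ℂ) :
    MvPolynomial.eval v (polyS l n p q) =
      S l n (MvPolynomial.eval v p) (MvPolynomial.eval v q) := by
  cases n with
  | zero => simp [S, polyS]
  | succ d => simp [S, polyS]

theorem infinite_image_ofReal_Ioo {a b : ℝ} (h : a < b) :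
    (((↑) : ℝ → ℂ) '' Set.Ioo a b).Infinite :=
  (Set.Ioo_infinite h).image Complex.ofReal_injective.injOn

/-- The multiplier of `ζ(l)` as a polynomial in two variables. -/
noncomputable def multiplierMvPoly (l : ℕ) : MvPolynomial (Fin 2) ℂ :=
  multiplierPoly (MvPolynomial.C ((1 + (-1) ^ l) * ((2 ^ (l - 1) - 1) / 2 ^ (l - 1)))) l
    (MvPolynomial.X 0) (MvPolynomial.X 1)

theorem eval_multiplierMvPoly (l : ℕ) (x y : ℂ) :
    MvPolynomial.eval ![x, y] (multiplierMvPoly l) =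
      multiplierPoly ((1 + (-1) ^ l) * ((2 ^ (l - 1) - 1) / 2 ^ (l - 1))) l x y := by
  simp [multiplierMvPoly, multiplierPoly]

theorem weighted_sum_formula {l : ℕ} (hl : 3 ≤ l) (x y : ℂ) :
    ∑ n ∈ Icc 2 (l - 1), (y - x) ^ (n - 2) * (S l n (x + y) y + (-1) ^ n * S l n (y + x) x) =
      MvPolynomial.eval ![x, y] (multiplierMvPoly l) * riemannZeta (l : ℂ) := by
  set X : MvPolynomial (Fin 2) ℂ := MvPolynomial.X 0 with hX
  set Y : MvPolynomial (Fin 2) ℂ := MvPolynomial.X 1 with hY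
  set Q : MvPolynomial (Fin 2) ℂ := ∑ n ∈ Icc 2 (l - 1), (Y - X) ^ (n - 2) *
    (polyS l n (X + Y) Y + (-1) ^ n * polyS l n (Y + X) X) with hQ
  have evalQ : ∀ x y : ℂ, MvPolynomial.eval ![x, y] Q = ∑ n ∈ Icc 2 (l - 1),
      (y - x) ^ (n - 2) * (S l n (x + y) y + (-1) ^ n * S l n (y + x) x) := fun x y => by
    simp [hQ, hX, hY, eval_polyS]
  have hfun : Q = multiplierMvPoly l * MvPolynomial.C (riemannZeta (l : ℂ)) := by
    -- The two intervals are disjoint and ordered, so every point of the product satisfies 0 < x < y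
    -- ≤ 1/8.
    refine MvPolynomial.funext_set ![((↑) : ℝ → ℂ) '' Set.Ioo 0 (1 / 16),
      ((↑) : ℝ → ℂ) '' Set.Ioo (1 / 16) (1 / 8)] ?_ ?_
    · intro i
      fin_cases i
      · exact infinite_image_ofReal_Ioo (by norm_num)
      · exact infinite_image_ofReal_Ioo (by norm_num)
    · intro v hv
      obtain ⟨a, ha, hav⟩ := hv 0 (Set.mem_univ _)
      obtain ⟨b, hb, hbv⟩ := hv 1 (Set.mem_univ _)
      have hv' : v = ![(a : ℂ), (b : ℂ)] := by
        funext i; fin_cases i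
        · exact hav.symm
        · exact hbv.symm
      have hab : a < b := ha.2.trans hb.1
      have hb0 : b ≠ 0 := (ha.1.trans hab).ne'
      have h := realLHS_eq (l := l) (by omega) ha.1 hab hb.2.le
      rw [hv', evalQ, map_mul, MvPolynomial.eval_C, eval_multiplierMvPoly,
        multiplierPoly_eq hl (by exact_mod_cast ha.1.ne') (by exact_mod_cast hb0)
          (by exact_mod_cast hab.ne), riemannZeta_natCast (by omega)]
      have h' := congrArg (fun r : ℝ => (r : ℂ)) h
      simp only [realLHS, multiplier] at h'
      push_cast [← S_ofReal] at h'
      rw [multiplier]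
      exact h'
  rw [← evalQ, hfun, map_mul, MvPolynomial.eval_C]

/-! ### The weighted Euler sum formula -/

theorem S_two_two_one (l : ℕ) : 2 * S l 2 2 1 =
    ∑ j ∈ Icc 2 (l - 1), (2 : ℂ) ^ j * (mzv ![j, l - j] : ℂ) := by
  rw [S, mul_sum]
  refine sum_bij' (fun k _ => k 0) (fun j _ => ![j, l - j]) ?_ ?_ ?_ ?_ ?_
  · intro k hk
    have h1 := add_le_of_mem_admissibleIndices hk
    have h2 := (mem_admissibleIndices.1 hk).2.1
    rw [mem_Icc]; omega
  · intro j hj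
    rw [mem_Icc] at hj
    rw [mem_admissibleIndices]
    refine ⟨by simp; omega, hj.1, fun i => ?_⟩
    fin_cases i <;> simp <;> omega
  · intro k hk
    have h1 := (mem_admissibleIndices.1 hk).1
    rw [Fin.sum_univ_two] at h1
    funext i
    fin_cases i
    · rfl
    · simp; omega
  · intro j _
    rfl
  · intro k hk
    obtain ⟨h1, h2, _⟩ := mem_admissibleIndices.1 hk
    rw [Fin.sum_univ_two] at h1
    have hk' : ![k 0, l - k 0] = k := by
      funext i
      fin_cases i
      · rfl
      · simp; omega
    rw [hk', one_pow, mul_one, ← mul_assoc, ← pow_succ', Nat.sub_add_cancel (by omega)]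

end WeightedSumMZV

theorem theorem2 (l : ℕ) (hl : 3 ≤ l) :
    -- the multiplier is a polynomial in `x, y`, given off its removable singularities by
    -- the displayed expression
    (∃ P : MvPolynomial (Fin 2) ℂ,
      (∀ x y : ℂ, x ≠ 0 → y ≠ 0 → x ≠ y →
        MvPolynomial.eval ![x, y] P =
          (y ^ (l + 1) - x ^ (l + 1)) / (y * x * (y - x)) -
            (y - x) ^ (l - 2) *
              ((1 + (-1) ^ l) * ((2 ^ (l - 1) - 1) / 2 ^ (l - 1)) +
                (-1) ^ l * (x / y) + y / x)) ∧
      (∀ x y : ℂ,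
        ∑ n ∈ Finset.Icc 2 (l - 1),
            (y - x) ^ (n - 2) *
              (WeightedSumMZV.S l n (x + y) y + (-1) ^ n * WeightedSumMZV.S l n (y + x) x) =
          MvPolynomial.eval ![x, y] P * riemannZeta (l : ℂ)) ∧
      -- at `x = y = 1` the multiplier is `l + 1`
      MvPolynomial.eval ![1, 1] P = (l : ℂ) + 1) ∧
    -- the weighted Euler sum formula, the case `x = y = 1`
    ∑ j ∈ Finset.Icc 2 (l - 1), (2 : ℂ) ^ j * (WeightedSumMZV.mzv ![j, l - j] : ℂ) =
      ((l : ℂ) + 1) * riemannZeta (l : ℂ) := by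
  open WeightedSumMZV in
  have hone : MvPolynomial.eval ![1, 1] (multiplierMvPoly l) = (l : ℂ) + 1 := by
    rw [eval_multiplierMvPoly, multiplierPoly_one_one hl]
  refine ⟨⟨WeightedSumMZV.multiplierMvPoly l, fun x y hx hy hxy => ?_,
    WeightedSumMZV.weighted_sum_formula hl, hone⟩, ?_⟩
  · rw [WeightedSumMZV.eval_multiplierMvPoly, WeightedSumMZV.multiplierPoly_eq hl hx hy hxy]
    rfl
  · have h := WeightedSumMZV.weighted_sum_formula hl 1 1
    -- At x = y = 1 the factor 0^(n−2) kills every depth but n = 2, where both summands equal `S l 2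
    -- 2 1`; splitting off the first term isolates that depth.
    rw [hone, WeightedSumMZV.sum_Icc_two, show l - 2 = (l - 3) + 1 by omega,
      Finset.sum_range_succ'] at h
    rw [← h, ← WeightedSumMZV.S_two_two_one]
    norm_num
    ring
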